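/- Let $\Omega=(0,1)^3$ with boundary $\Gamma$, and let $L^2(\Omega)$ be the real Lebesgue spaces of scalar functions or vector fields. For $\Gamma_\tau\subset\Gamma$ let $\Gamma_\nu=\Gamma\setminus\overline{\Gamma_\tau}$, and let $\operatorname{grad}_{\Gamma_\tau}$ and $\operatorname{rot}_{\Gamma_\tau}$ be the closures, as unbounded operators on $L^2(\Omega)$, of the gradient and the rotation (curl) acting on restrictions to $\Omega$ of functions, respectively vector fields, in $C^\infty(\mathbb R^3)$ with compact support of positive distance to $\Gamma_\tau$ (no distance condition if $\Gamma_\tau=\emptyset$). For a densely defined closed operator $A$ between Hilbert spaces let $c_A\in[0,\infty]$ be given by $$\frac1{c_A}=\inf\Big\{\frac{\|Ax\|}{\|x\|}\,:\,0\neq x\in D(A)\cap\overline{R(A^*)}\Big\},$$ and put $c_{0,\Gamma_\tau}=c_{\operatorname{grad}_{\Gamma_\tau}}$ (Laplace constant) and $c_{1,\Gamma_\tau}=c_{\operatorname{rot}_{\Gamma_\tau}}$ (Maxwell constant). Let $\Gamma_\tau$ be any union of faces of the cube, i.e. the interior, relative to $\Gamma$, of the closure of the union of the open faces in a set $T$ of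 faces. There are six faces, two opposite ones for each of the three coordinate directions. Then $c_{0,\Gamma_\tau}$ and $c_{1,\Gamma_\tau}$ have the following values. $$\begin{array}{l|c|c} \text{faces in } T & c_{0,\Gamma_\tau} & c_{1,\Gamma_\tau}\\\hline \text{none }(\Gamma_\tau=\emptyset) & \frac1\pi & \frac1{\sqrt2\,\pi}\\ \text{one face} & \frac2\pi & \frac2{\sqrt5\,\pi}\\ \text{two opposite faces} & \frac1\pi & \frac1\pi\\ \text{two adjacent faces} & \frac{\sqrt2}\pi & \frac{\sqrt2}\pi\\ \text{three faces, two of them opposite} & \frac2{\sqrt5\,\pi} & \frac2\pi\\ \text{three pairwise adjacent faces} & \frac2{\sqrt3\,\pi} & \frac2{\sqrt3\,\pi}\\ \text{four faces, two opposite pairs} & \frac1{\sqrt2\,\pi} & \frac1\pi\\ \text{four faces, exactly one opposite pair} & \frac2{\sqrt6\,\pi} & \frac{\sqrt2}\pi\\ \text{five faces} & \frac2{3\pi} & \frac2{\sqrt5\,\pi}\\ \text{all faces }(\Gamma_\tau=\Gamma) & \frac1{\sqrt3\,\pi} & \frac1{\sqrt2\,\pi} \end{array}$$ Moreover, $c_{1,\Gamma_\nu}=c_{1,\Gamma_\tau}$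 for every such $\Gamma_\tau$. -/

import Mathlib

open MeasureTheory Set
open scoped ENNReal

/-- Euclidean three-space `ℝ³`. -/
abbrev R3 : Type := EuclideanSpace ℝ (Fin 3)

/-- The Hilbert space `L²(Ω)` of real scalar functions. -/
abbrev L2s (Ω : Set R3) : Type := Lp ℝ 2 (volume.restrict Ω)

/-- The Hilbert space `L²(Ω)` of real vector fields. -/
abbrev L2v (Ω : Set R3) : Type := Lp R3 2 (volume.restrict Ω)

/-- The partial derivative `∂ⱼ Eᵢ` of a vector field. -/
noncomputable def partialD (E : R3 → R3) (j i : Fin 3) (x : R3) : ℝ :=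
  (fderiv ℝ E x (EuclideanSpace.single j 1)) i

/-- The rotation (curl) of a vector field. -/
noncomputable def rot (E : R3 → R3) (x : R3) : R3 :=
  !₂[partialD E 1 2 x - partialD E 2 1 x,
     partialD E 2 0 x - partialD E 0 2 x,
     partialD E 0 1 x - partialD E 1 0 x]

/-- Test functions (or fields) for the boundary part `Γτ`: smooth on `ℝ³` with compact support
that has positive distance to `Γτ` (no condition if `Γτ` is empty). -/
structure IsTest {V : Type*} [NormedAddCommGroup V] [NormedSpace ℝ V]
    (Γτ : Set R3) (φ : R3 → V) : Prop where
  smooth : ContDiff ℝ (⊤ : ℕ∞) φ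
  compact : HasCompactSupport φ
  dist_pos : ∃ δ : ℝ, 0 < δ ∧ ∀ x ∈ tsupport φ, ∀ y ∈ Γτ, δ ≤ dist x y

section IsTestLemmas

variable {V : Type*} [NormedAddCommGroup V] [NormedSpace ℝ V] {Γτ : Set R3} {φ ψ : R3 → V}

theorem IsTest.zero : IsTest Γτ (0 : R3 → V) where
  smooth := contDiff_const
  compact := HasCompactSupport.zero
  dist_pos := ⟨1, one_pos, fun x hx => by simp [tsupport] at hx⟩

theorem IsTest.add (hφ : IsTest Γτ φ) (hψ : IsTest Γτ ψ) : IsTest Γτ (φ + ψ) where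
  smooth := hφ.smooth.add hψ.smooth
  compact := hφ.compact.add hψ.compact
  dist_pos := by
    obtain ⟨δ, hδ, h1⟩ := hφ.dist_pos
    obtain ⟨ε, hε, h2⟩ := hψ.dist_pos
    refine ⟨min δ ε, lt_min hδ hε, fun x hx y hy => ?_⟩
    rcases tsupport_add φ ψ hx with h | h
    · exact (min_le_left _ _).trans (h1 x h y hy)
    · exact (min_le_right _ _).trans (h2 x h y hy)

theorem IsTest.smul (c : ℝ) (hφ : IsTest Γτ φ) : IsTest Γτ (c • φ) where
  smooth := hφ.smooth.const_smul c
  compact := hφ.compact.mono (Function.support_const_smul_subset c φ)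
  dist_pos := by
    obtain ⟨δ, hδ, h1⟩ := hφ.dist_pos
    exact ⟨δ, hδ, fun x hx y hy =>
      h1 x (closure_mono (Function.support_const_smul_subset c φ) hx) y hy⟩

theorem IsTest.differentiableAt (hφ : IsTest Γτ φ) (x : R3) : DifferentiableAt ℝ φ x :=
  (hφ.smooth.differentiable (by simp)) x

end IsTestLemmas

theorem gradient_add_of_test {Γτ : Set R3} {φ ψ : R3 → ℝ} (hφ : IsTest Γτ φ) (hψ : IsTest Γτ ψ) :
    gradient (φ + ψ) = gradient φ + gradient ψ := by
  funext x
  simp [gradient, fderiv_add (hφ.differentiableAt x) (hψ.differentiableAt x)]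

theorem gradient_smul_of_test {Γτ : Set R3} {φ : R3 → ℝ} (c : ℝ) (hφ : IsTest Γτ φ) :
    gradient (c • φ) = c • gradient φ := by
  funext x
  simp [gradient, fderiv_const_smul (hφ.differentiableAt x) c]

theorem rot_add_of_test {Γτ : Set R3} {φ ψ : R3 → R3} (hφ : IsTest Γτ φ) (hψ : IsTest Γτ ψ) :
    rot (φ + ψ) = rot φ + rot ψ := by
  funext x
  ext i
  fin_cases i <;>
    simp [rot, partialD, fderiv_add (hφ.differentiableAt x) (hψ.differentiableAt x)] <;> ring

theorem rot_smul_of_test {Γτ : Set R3} {φ : R3 → R3} (c : ℝ) (hφ : IsTest Γτ φ) :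
    rot (c • φ) = c • rot φ := by
  funext x
  ext i
  fin_cases i <;>
    simp [rot, partialD, fderiv_const_smul (hφ.differentiableAt x) c] <;> ring

/-- The graph of the gradient on (restrictions to `Ω` of) test functions, inside
`L²(Ω) × L²(Ω)`. -/
def gradTestGraph (Ω Γτ : Set R3) : Submodule ℝ (L2s Ω × L2v Ω) where
  carrier := {p | ∃ φ : R3 → ℝ, IsTest Γτ φ ∧ p.1 =ᵐ[volume.restrict Ω] φ ∧
    p.2 =ᵐ[volume.restrict Ω] gradient φ}
  zero_mem' := ⟨0, IsTest.zero, Lp.coeFn_zero _ _ _, by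
    have h : gradient (0 : R3 → ℝ) = 0 := by funext x; simp [gradient]
    rw [h]; exact Lp.coeFn_zero _ _ _⟩
  add_mem' := by
    rintro p q ⟨φ, hφ, hp1, hp2⟩ ⟨ψ, hψ, hq1, hq2⟩
    refine ⟨φ + ψ, hφ.add hψ, (Lp.coeFn_add _ _).trans (hp1.add hq1), ?_⟩
    rw [gradient_add_of_test hφ hψ]
    exact (Lp.coeFn_add _ _).trans (hp2.add hq2)
  smul_mem' := by
    rintro c p ⟨φ, hφ, hp1, hp2⟩
    refine ⟨c • φ, hφ.smul c, (Lp.coeFn_smul _ _).trans (hp1.const_smul c), ?_⟩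
    rw [gradient_smul_of_test c hφ]
    exact (Lp.coeFn_smul _ _).trans (hp2.const_smul c)

/-- The graph of the rotation on (restrictions to `Ω` of) test fields, inside
`L²(Ω) × L²(Ω)`. -/
def rotTestGraph (Ω Γτ : Set R3) : Submodule ℝ (L2v Ω × L2v Ω) where
  carrier := {p | ∃ Φ : R3 → R3, IsTest Γτ Φ ∧ p.1 =ᵐ[volume.restrict Ω] Φ ∧
    p.2 =ᵐ[volume.restrict Ω] rot Φ}
  zero_mem' := ⟨0, IsTest.zero, Lp.coeFn_zero _ _ _, by
    have h : rot (0 : R3 → R3) = 0 := by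
      funext x; ext i; fin_cases i <;> simp [rot, partialD]
    rw [h]; exact Lp.coeFn_zero _ _ _⟩
  add_mem' := by
    rintro p q ⟨φ, hφ, hp1, hp2⟩ ⟨ψ, hψ, hq1, hq2⟩
    refine ⟨φ + ψ, hφ.add hψ, (Lp.coeFn_add _ _).trans (hp1.add hq1), ?_⟩
    rw [rot_add_of_test hφ hψ]
    exact (Lp.coeFn_add _ _).trans (hp2.add hq2)
  smul_mem' := by
    rintro c p ⟨φ, hφ, hp1, hp2⟩
    refine ⟨c • φ, hφ.smul c, (Lp.coeFn_smul _ _).trans (hp1.const_smul c), ?_⟩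
    rw [rot_smul_of_test c hφ]
    exact (Lp.coeFn_smul _ _).trans (hp2.const_smul c)

/-- The operator `grad_{Γτ}` on `L²(Ω)`: the closure of the gradient on test functions, i.e. the
operator whose graph is the closure of `gradTestGraph Ω Γτ`. Its domain is `H_{Γτ}(grad, Ω)`. -/
noncomputable def gradOp (Ω Γτ : Set R3) : L2s Ω →ₗ.[ℝ] L2v Ω :=
  (gradTestGraph Ω Γτ).topologicalClosure.toLinearPMap

/-- The operator `rot_{Γτ}` on `L²(Ω)`: the closure of the rotation on test fields, i.e. the
operator whose graph is the closure of `rotTestGraph Ω Γτ`. Its domain is `H_{Γτ}(rot, Ω)`. -/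
noncomputable def rotOp (Ω Γτ : Set R3) : L2v Ω →ₗ.[ℝ] L2v Ω :=
  (rotTestGraph Ω Γτ).topologicalClosure.toLinearPMap

/-- The (best) Poincaré-Friedrichs type constant `c_A ∈ [0, ∞]` of a densely defined closed
operator `A`, given by `1 / c_A = inf ‖A x‖ / ‖x‖` over all `0 ≠ x ∈ D(A) ∩ closure (R(A*))`. -/
noncomputable def poincareConst {H K : Type*} [NormedAddCommGroup H] [InnerProductSpace ℝ H]
    [CompleteSpace H] [NormedAddCommGroup K] [InnerProductSpace ℝ K]
    (A : H →ₗ.[ℝ] K) : ℝ≥0∞ :=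
  (⨅ (x : A.domain) (_ : (x : H) ≠ 0) (_ : (x : H) ∈ closure (range A.adjoint)),
    ‖A x‖ₑ / ‖(x : H)‖ₑ)⁻¹

/-- The Laplace (Poincaré-Friedrichs) constant `c_{0,Γτ}` of `Ω`. -/
noncomputable def laplaceConst (Ω Γτ : Set R3) : ℝ≥0∞ := poincareConst (gradOp Ω Γτ)

/-- The Maxwell constant `c_{1,Γτ}` of `Ω`. -/
noncomputable def maxwellConst (Ω Γτ : Set R3) : ℝ≥0∞ := poincareConst (rotOp Ω Γτ)

/-- The open unit cube `(0,1)³`. -/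
def unitCube : Set R3 := {x | ∀ i, x i ∈ Ioo (0 : ℝ) 1}

/-- The open face of the unit cube in the plane `xᵢ = s`, `s ∈ {0,1}`, for `p = (i, s)`. With
coordinates numbered `0, 1, 2`, the back, front, left, right, bottom, top faces are
`(0,0), (0,1), (1,0), (1,1), (2,0), (2,1)`. -/
def cubeFace (p : Fin 3 × Fin 2) : Set R3 :=
  {x | x p.1 = ((p.2 : ℕ) : ℝ) ∧ ∀ j, j ≠ p.1 → x j ∈ Ioo (0 : ℝ) 1}

/-- The boundary part made of the faces in `T`: the interior, relative to the boundary `Γ` of the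
cube, of the closure of the union of these open faces. -/
def facePart (T : Set (Fin 3 × Fin 2)) : Set R3 :=
  {x | x ∈ frontier unitCube ∧ ∃ U : Set R3, IsOpen U ∧ x ∈ U ∧
    U ∩ frontier unitCube ⊆ closure (⋃ p ∈ T, cubeFace p)}

/-- `c_{0,Γτ}` for the unit cube, `Γτ` being the boundary part made of the faces in `T`. -/
noncomputable def cubeC0 (T : Set (Fin 3 × Fin 2)) : ℝ≥0∞ := laplaceConst unitCube (facePart T)

/-- `c_{1,Γτ}` for the unit cube, `Γτ` being the boundary part made of the faces in `T`. -/
noncomputable def cubeC1 (T : Set (Fin 3 × Fin 2)) : ℝ≥0∞ := maxwellConst unitCube (facePart T)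

open Filter Topology

/-! The cube separates variables. In direction `i` use the eigenfunctions of `-u''` on `(0,1)` that
vanish on the faces in `T` (`faceDir`), together with their normalized derivatives (`faceNeu`),
which satisfy the exchanged conditions. The frequencies are `kπ` if none or both of the two faces
lie in `T`, and `(k + 1/2)π` if exactly one does. Differentiating a product of such functions in
direction `i` multiplies it by the frequency `ω i` and exchanges the factor in that direction.

Hence, in product bases, both operators are block diagonal. The gradient becomes multiplication of a
number by the vector `ω`, and the rotation becomes `a ↦ ω × a` on amplitudes in `ℝ³`
(`isBlockDiagonal_grad`, `isBlockDiagonal_rot`). Integration by parts gives the coefficient identity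
for test functions, and it passes to the closure. Conversely, cutoffs show that the basis functions
lie in the domain of the closure. Off the kernel both symbols stretch by exactly `|ω|`: for the
rotation the admissible amplitudes are orthogonal to `ω`, and then `|ω × a| = |ω||a|`. So by
`IsBlockDiagonal.poincareConst_eq` each constant is the inverse of the least `|ω|` that occurs with
a nonzero mode (`laplaceConst_eq`, `maxwellConst_eq`).

The bases enter only through the Parseval identity, so they may contain zeros. In one dimension it
comes from Fourier series of period 4 for all four pairs of end conditions at once
(`isParsevalFrame_dirFun`), and it tensorizes by Fubini. What remains is a small minimization: a
zero frequency may kill components of a mode, and for the rotation this decides how many frequencies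
can vanish. Passing to the complementary boundary part keeps all frequencies, and `a ↦ ω × a`
carries admissible amplitudes to admissible ones (`RotAdmissible.compl`), so the Maxwell constants
agree. -/

/-- The measure of the unit interval. -/
noncomputable abbrev unitIntervalMeasure : Measure ℝ := volume.restrict (Ioo (0 : ℝ) 1)

/-! ### One-dimensional eigenfunctions with mixed boundary conditions -/

/-- Frequencies of the eigenfunctions of `-u''` on `(0,1)` with a Dirichlet condition at `0`
iff `p` and at `1` iff `q`, and Neumann conditions otherwise. -/
noncomputable def freq (p q : Prop) (n : ℕ) : ℝ :=
  open Classical in (if (p ↔ q) then (n : ℝ) else n + 1 / 2) * Real.pi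

/-- Normalizing amplitudes. -/
noncomputable def amp (p q : Prop) (n : ℕ) : ℝ :=
  open Classical in if freq p q n = 0 then 1 else √2

/-- Eigenfunctions for the mixed boundary conditions. -/
noncomputable def dirFun (p q : Prop) (n : ℕ) (x : ℝ) : ℝ :=
  open Classical in
  amp p q n * if p then Real.sin (freq p q n * x) else Real.cos (freq p q n * x)

/-- Eigenfunctions for the exchanged boundary conditions (normalized derivatives of `dirFun`). -/
noncomputable def neuFun (p q : Prop) (n : ℕ) (x : ℝ) : ℝ :=
  open Classical in
  amp p q n * if p then Real.cos (freq p q n * x) else -Real.sin (freq p q n * x)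

section OneDim

variable {p q : Prop} {n m : ℕ}

theorem freq_nonneg : 0 ≤ freq p q n := by
  unfold freq
  split_ifs <;> positivity

theorem freq_injective (p q : Prop) : Function.Injective (freq p q) := by
  intro n m h
  unfold freq at h
  have h2 := mul_right_cancel₀ Real.pi_ne_zero h
  split_ifs at h2 <;> simpa using h2

theorem amp_sq_le : amp p q n ^ 2 ≤ 2 := by
  unfold amp
  split_ifs <;> norm_num

theorem abs_amp_le : |amp p q n| ≤ 2 :=
  abs_le_of_sq_le_sq (by linarith [amp_sq_le (p := p) (q := q) (n := n)]) (by norm_num)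

theorem abs_dirFun_le (x : ℝ) : |dirFun p q n x| ≤ 2 := by
  unfold dirFun
  rw [abs_mul, ← mul_one 2]
  refine mul_le_mul abs_amp_le ?_ (abs_nonneg _) zero_le_two
  split_ifs
  · exact Real.abs_sin_le_one _
  · exact Real.abs_cos_le_one _

theorem abs_neuFun_le (x : ℝ) : |neuFun p q n x| ≤ 2 := by
  unfold neuFun
  rw [abs_mul, ← mul_one 2]
  refine mul_le_mul abs_amp_le ?_ (abs_nonneg _) zero_le_two
  split_ifs
  · exact Real.abs_cos_le_one _
  · simpa using Real.abs_sin_le_one _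

theorem contDiff_dirFun : ContDiff ℝ (⊤ : ℕ∞) (dirFun p q n) := by
  unfold dirFun
  split_ifs <;> fun_prop

theorem contDiff_neuFun : ContDiff ℝ (⊤ : ℕ∞) (neuFun p q n) := by
  unfold neuFun
  split_ifs <;> fun_prop

theorem hasDerivAt_dirFun (x : ℝ) :
    HasDerivAt (dirFun p q n) (freq p q n * neuFun p q n x) x := by
  have h : HasDerivAt (fun x => freq p q n * x) (freq p q n) x := by
    simpa using (hasDerivAt_id x).const_mul (freq p q n)
  unfold dirFun neuFun
  split_ifs
  · exact (h.sin.const_mul (amp p q n)).congr_deriv (by ring)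
  · exact (h.cos.const_mul (amp p q n)).congr_deriv (by ring)

theorem hasDerivAt_neuFun (x : ℝ) :
    HasDerivAt (neuFun p q n) (-(freq p q n * dirFun p q n x)) x := by
  have h : HasDerivAt (fun x => freq p q n * x) (freq p q n) x := by
    simpa using (hasDerivAt_id x).const_mul (freq p q n)
  unfold dirFun neuFun
  split_ifs
  · exact (h.cos.const_mul (amp p q n)).congr_deriv (by ring)
  · exact (h.sin.neg.const_mul (amp p q n)).congr_deriv (by ring)

theorem continuous_dirFun : Continuous (dirFun p q n) := contDiff_dirFun.continuous

theorem continuous_neuFun : Continuous (neuFun p q n) := contDiff_neuFun.continuous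

theorem dirFun_zero (hp : p) : dirFun p q n 0 = 0 := by simp [dirFun, hp]

theorem neuFun_zero (hp : ¬p) : neuFun p q n 0 = 0 := by simp [neuFun, hp]

theorem sin_freq (h : p ↔ q) : Real.sin (freq p q n) = 0 := by
  simp [freq, h]

theorem cos_freq (h : ¬(p ↔ q)) : Real.cos (freq p q n) = 0 := by
  rw [Real.cos_eq_zero_iff]
  refine ⟨n, ?_⟩
  simp only [freq, if_neg h, Int.cast_natCast]
  ring

theorem dirFun_one (hq : q) : dirFun p q n 1 = 0 := by
  by_cases hp : p
  · simp only [dirFun, if_pos hp, mul_one, sin_freq (n := n) (show p ↔ q by tauto), mul_zero]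
  · simp only [dirFun, if_neg hp, mul_one, cos_freq (n := n) (show ¬(p ↔ q) by tauto), mul_zero]

theorem neuFun_one (hq : ¬q) : neuFun p q n 1 = 0 := by
  by_cases hp : p
  · simp only [neuFun, if_pos hp, mul_one, cos_freq (n := n) (show ¬(p ↔ q) by tauto), mul_zero]
  · simp only [neuFun, if_neg hp, mul_one, sin_freq (n := n) (show p ↔ q by tauto), mul_zero, neg_zero]

/-- Integration by parts on the unit interval. -/
theorem integral_Ioo_deriv_mul_neuFun {w w' : ℝ → ℝ} (hw : ∀ x, HasDerivAt w (w' x) x)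
    (hw' : Continuous w') (h0 : p → w 0 = 0) (h1 : q → w 1 = 0) :
    ∫ x in Ioo (0 : ℝ) 1, w' x * neuFun p q n x =
      freq p q n * ∫ x in Ioo (0 : ℝ) 1, w x * dirFun p q n x := by
  have hwc : Continuous w := continuous_iff_continuousAt.2 fun x => (hw x).continuousAt
  have key := intervalIntegral.integral_mul_deriv_eq_deriv_mul (a := 0) (b := 1)
    (fun x _ => hw x) (fun x _ => hasDerivAt_neuFun (p := p) (q := q) (n := n) x)
    (hw'.intervalIntegrable _ _)
    ((continuous_const.mul continuous_dirFun).neg.intervalIntegrable _ _)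
  -- Each boundary term vanishes: at an endpoint with a Dirichlet condition `w` is zero, and at the
  -- others `neuFun` is.
  have e0 : w 0 * neuFun p q n 0 = 0 := by
    by_cases hp : p
    · simp [h0 hp]
    · simp [neuFun_zero hp]
  have e1 : w 1 * neuFun p q n 1 = 0 := by
    by_cases hq : q
    · simp [h1 hq]
    · simp [neuFun_one hq]
  have e2 : ∀ x, w x * -(freq p q n * dirFun p q n x) =
      -freq p q n * (w x * dirFun p q n x) := fun x => by ring
  simp only [e0, e1, e2, intervalIntegral.integral_const_mul] at key
  rw [← integral_Ioc_eq_integral_Ioo, ← integral_Ioc_eq_integral_Ioo,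
    ← intervalIntegral.integral_of_le zero_le_one, ← intervalIntegral.integral_of_le zero_le_one]
  linarith

theorem freq_mul_integral_neuFun :
    freq p q n * ∫ x in Ioo (0 : ℝ) 1, neuFun p q n x * neuFun p q m x =
      freq p q m * ∫ x in Ioo (0 : ℝ) 1, dirFun p q n x * dirFun p q m x := by
  rw [← integral_Ioo_deriv_mul_neuFun hasDerivAt_dirFun
    (continuous_const.mul continuous_neuFun) dirFun_zero dirFun_one]
  rw [← integral_const_mul]
  simp only [mul_assoc]

/-- Integrating by parts with the two indices in either order gives `ω_n B = ω_m A` and `ω_m B = ω_n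
A`, where `A` pairs the `dirFun` and `B` the `neuFun`. Eliminating `B` leaves `(ω_n² - ω_m²) A = 0`,
and the frequencies are nonnegative and distinct. -/
theorem integral_dirFun_mul_dirFun (h : n ≠ m) :
    ∫ x in Ioo (0 : ℝ) 1, dirFun p q n x * dirFun p q m x = 0 := by
  have h1 := freq_mul_integral_neuFun (p := p) (q := q) (n := n) (m := m)
  have h2 := freq_mul_integral_neuFun (p := p) (q := q) (n := m) (m := n)
  simp only [mul_comm (neuFun p q m _), mul_comm (dirFun p q m _)] at h2
  have h3 : freq p q n ^ 2 ≠ freq p q m ^ 2 := fun h4 =>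
    h (freq_injective p q ((sq_eq_sq₀ freq_nonneg freq_nonneg).1 h4))
  set A := ∫ x in Ioo (0 : ℝ) 1, dirFun p q n x * dirFun p q m x
  set B := ∫ x in Ioo (0 : ℝ) 1, neuFun p q n x * neuFun p q m x
  have : (freq p q n ^ 2 - freq p q m ^ 2) * A = 0 := by linear_combination freq p q m * h1 - freq p q n * h2
  exact (mul_eq_zero.1 this).resolve_left (sub_ne_zero.2 h3)

theorem dirFun_sq_add_neuFun_sq (x : ℝ) :
    dirFun p q n x * dirFun p q n x + neuFun p q n x * neuFun p q n x = amp p q n ^ 2 := by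
  unfold dirFun neuFun
  split_ifs <;> linear_combination amp p q n ^ 2 * Real.sin_sq_add_cos_sq (freq p q n * x)

theorem integrable_unitInterval {f : ℝ → ℝ} (hf : Continuous f) :
    Integrable f unitIntervalMeasure :=
  (hf.continuousOn.integrableOn_compact isCompact_Icc).mono_set Ioo_subset_Icc_self

/-- For nonzero frequency `dirFun` and `neuFun` have equal norms, whose squares add up to the
squared amplitude, at most 2. For frequency zero the amplitude is 1. Only an inequality holds in
general, since `dirFun` may be the zero function there. -/
theorem integral_dirFun_sq_le :
    ∫ x in Ioo (0 : ℝ) 1, dirFun p q n x * dirFun p q n x ≤ 1 := by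
  have i1 := integrable_unitInterval
    ((continuous_dirFun (p := p) (q := q) (n := n)).mul
      (continuous_dirFun (p := p) (q := q) (n := n)))
  have i2 := integrable_unitInterval
    ((continuous_neuFun (p := p) (q := q) (n := n)).mul
      (continuous_neuFun (p := p) (q := q) (n := n)))
  have hs := integral_add i1 i2
  simp only [Pi.mul_apply, dirFun_sq_add_neuFun_sq] at hs
  simp only [integral_const, measureReal_restrict_apply MeasurableSet.univ, univ_inter,
    Real.volume_real_Ioo, sub_zero, max_eq_left zero_le_one, one_smul] at hs
  have hB : 0 ≤ ∫ x in Ioo (0 : ℝ) 1, neuFun p q n x * neuFun p q n x :=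
    integral_nonneg fun x => mul_self_nonneg _
  by_cases h : freq p q n = 0
  · have : amp p q n = 1 := by simp [amp, h]
    rw [this] at hs
    linarith
  · have h2 := mul_left_cancel₀ h (freq_mul_integral_neuFun (p := p) (q := q) (n := n) (m := n))
    have := amp_sq_le (p := p) (q := q) (n := n)
    linarith

end OneDim

/-! ### Parseval families and Bessel's inequality -/

section Frames

variable {X Y ι κ : Type*} [MeasurableSpace X] [MeasurableSpace Y]

/-- A family with the Parseval identity in `L²(μ)` (an orthonormal basis, possibly with zeros
added). -/
def IsParsevalFrame (μ : Measure X) (e : ι → X → ℝ) : Prop :=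
  ∀ f : X → ℝ, MemLp f 2 μ → ∑' n, ‖∫ x, f x * e n x ∂μ‖ₑ ^ 2 = ∫⁻ x, ‖f x‖ₑ ^ 2 ∂μ

theorem inner_toLp_real {μ : Measure X} {f g : X → ℝ} (hf : MemLp f 2 μ) (hg : MemLp g 2 μ) :
    inner ℝ (hf.toLp f) (hg.toLp g) = ∫ x, f x * g x ∂μ := by
  rw [L2.inner_def]
  refine integral_congr_ae ?_
  filter_upwards [hf.coeFn_toLp, hg.coeFn_toLp] with x h1 h2
  rw [h1, h2]
  simp [mul_comm]

theorem lintegral_enorm_sq_eq {μ : Measure X} {E : Type*} [NormedAddCommGroup E]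
    {f : X → E} (hf : MemLp f 2 μ) :
    ∫⁻ x, ‖f x‖ₑ ^ 2 ∂μ = ‖hf.toLp f‖ₑ ^ 2 := by
  rw [Lp.enorm_toLp, eLpNorm_eq_lintegral_rpow_enorm_toReal (by norm_num) (by norm_num)]
  rw [← ENNReal.rpow_natCast, ← ENNReal.rpow_mul]
  simp

/-- Bessel's inequality, from `‖x - ∑ ⟨x, eᵢ⟩ eᵢ‖² ≥ 0`. Norms at most 1 suffice, so members of the
family may vanish. -/
theorem sum_inner_sq_le_of_orthogonal {H : Type*} [NormedAddCommGroup H] [InnerProductSpace ℝ H]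
    {e : ι → H} (h0 : ∀ i j, i ≠ j → inner ℝ (e i) (e j) = 0) (h1 : ∀ i, ‖e i‖ ≤ 1)
    (x : H) (s : Finset ι) : ∑ i ∈ s, inner ℝ x (e i) ^ 2 ≤ ‖x‖ ^ 2 := by
  classical
  have hxs : inner ℝ x (∑ i ∈ s, inner ℝ x (e i) • e i) = ∑ i ∈ s, inner ℝ x (e i) ^ 2 := by
    simp [inner_sum, real_inner_smul_right, sq]
  have hss : ‖∑ i ∈ s, inner ℝ x (e i) • e i‖ ^ 2 ≤ ∑ i ∈ s, inner ℝ x (e i) ^ 2 := by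
    rw [← real_inner_self_eq_norm_sq, sum_inner]
    refine Finset.sum_le_sum fun i hi => ?_
    rw [inner_sum, Finset.sum_eq_single i]
    · rw [real_inner_smul_left, real_inner_smul_right, real_inner_self_eq_norm_sq]
      have := mul_le_mul_of_nonneg_left (pow_le_one₀ (n := 2) (norm_nonneg _) (h1 i))
        (sq_nonneg (inner ℝ x (e i)))
      linarith
    · intro j _ hj
      rw [real_inner_smul_left, real_inner_smul_right, h0 i j hj.symm]
      simp
    · exact fun h => absurd hi h
  have := norm_sub_sq_real x (∑ i ∈ s, inner ℝ x (e i) • e i)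
  rw [hxs] at this
  nlinarith [sq_nonneg ‖x - ∑ i ∈ s, inner ℝ x (e i) • e i‖]

theorem tsum_enorm_sq_le_of_orthogonal {μ : Measure X} {e : ι → X → ℝ}
    (he : ∀ i, MemLp (e i) 2 μ) (h0 : ∀ i j, i ≠ j → ∫ x, e i x * e j x ∂μ = 0)
    (h1 : ∀ i, ∫ x, e i x * e i x ∂μ ≤ 1) {f : X → ℝ} (hf : MemLp f 2 μ) :
    ∑' n, ‖∫ x, f x * e n x ∂μ‖ₑ ^ 2 ≤ ∫⁻ x, ‖f x‖ₑ ^ 2 ∂μ := by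
  rw [lintegral_enorm_sq_eq hf, ENNReal.tsum_eq_iSup_sum]
  refine iSup_le fun s => ?_
  have := sum_inner_sq_le_of_orthogonal (e := fun i => (he i).toLp (e i))
    (fun i j hij => by rw [inner_toLp_real]; exact h0 i j hij)
    (fun i => by
      rw [← sq_le_one_iff₀ (norm_nonneg _), ← real_inner_self_eq_norm_sq, inner_toLp_real]
      exact h1 i) (hf.toLp f) s
  simp only [inner_toLp_real] at this
  have h2 := ENNReal.ofReal_le_ofReal this
  rw [ENNReal.ofReal_sum_of_nonneg fun i _ => sq_nonneg _] at h2
  rw [ENNReal.ofReal_pow (norm_nonneg _), ofReal_norm] at h2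
  refine le_trans (le_of_eq (Finset.sum_congr rfl fun i _ => ?_)) h2
  rw [← sq_abs, ENNReal.ofReal_pow (abs_nonneg _), ← Real.norm_eq_abs, ofReal_norm]

end Frames

/-! ### Completeness of the four trigonometric systems -/

/-- Extension by zero to period 4 makes the Fourier frequencies the multiples of `π/2`, hence all
integer and half-integer multiples of `π`. As `f` is real, the cosine and sine integrals are the
real and imaginary parts; `1/16` is the square of the normalization `1/4`. -/
theorem norm_fourierCoeffOn_indicator_sq {f : ℝ → ℝ} (hf : MemLp f 2 unitIntervalMeasure) (i : ℤ) :
    ‖fourierCoeffOn (show (0 : ℝ) < 4 by norm_num)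
        ((Ioo (0 : ℝ) 1).indicator fun x => (f x : ℂ)) i‖ ^ 2 =
      (1 / 16) * ((∫ x in Ioo (0 : ℝ) 1, f x * Real.cos (i * (Real.pi / 2) * x)) ^ 2 +
        (∫ x in Ioo (0 : ℝ) 1, f x * Real.sin (i * (Real.pi / 2) * x)) ^ 2) := by
  have hfi : Integrable f unitIntervalMeasure := hf.integrable (by norm_num)
  have hc : Integrable (fun x => f x * Real.cos (i * (Real.pi / 2) * x)) unitIntervalMeasure :=
    hfi.mul_bdd (c := 1) (by fun_prop) (ae_of_all _ fun x => Real.abs_cos_le_one _)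
  have hs : Integrable (fun x => f x * Real.sin (i * (Real.pi / 2) * x)) unitIntervalMeasure :=
    hfi.mul_bdd (c := 1) (by fun_prop) (ae_of_all _ fun x => Real.abs_sin_le_one _)
  have key : fourierCoeffOn (show (0 : ℝ) < 4 by norm_num)
        ((Ioo (0 : ℝ) 1).indicator fun x => (f x : ℂ)) i =
      (1 / 4 : ℝ) * (((∫ x in Ioo (0 : ℝ) 1, f x * Real.cos (i * (Real.pi / 2) * x) : ℝ) : ℂ) -
        ((∫ x in Ioo (0 : ℝ) 1, f x * Real.sin (i * (Real.pi / 2) * x) : ℝ) : ℂ) *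
          Complex.I) := by
    rw [fourierCoeffOn_eq_integral, intervalIntegral.integral_of_le (by norm_num),
      ← integral_complex_ofReal, ← integral_complex_ofReal, ← integral_mul_const,
      ← integral_sub hc.ofReal (hs.ofReal.mul_const _), sub_zero, Complex.real_smul]
    congr 1
    rw [← integral_indicator measurableSet_Ioc, ← integral_indicator measurableSet_Ioo]
    refine integral_congr_ae (ae_of_all _ fun x => ?_)
    by_cases hx : x ∈ Ioo (0 : ℝ) 1
    · have hx' : x ∈ Ioc (0 : ℝ) 4 := ⟨hx.1, by linarith [hx.2]⟩
      simp only [indicator_of_mem hx, indicator_of_mem hx', fourier_coe_apply, smul_eq_mul]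
      have : 2 * (Real.pi : ℂ) * Complex.I * ((-i : ℤ) : ℂ) * (x : ℂ) / ((4 : ℝ) : ℂ) =
          ((-(i * (Real.pi / 2) * x) : ℝ) : ℂ) * Complex.I := by
        push_cast; ring
      rw [this, Complex.exp_mul_I, ← Complex.ofReal_cos, ← Complex.ofReal_sin,
        Real.cos_neg, Real.sin_neg]
      push_cast; ring
    · have : ∀ g : ℝ → ℂ, (Ioc (0 : ℝ) 4).indicator
          (fun x => g x • (Ioo (0 : ℝ) 1).indicator (fun x => (f x : ℂ)) x) x = 0 := fun g => by
        simp only [indicator, if_neg hx, smul_zero, ite_self]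
      simp only [this, indicator_of_notMem hx]
  rw [key, Complex.norm_mul, mul_pow, ← Complex.normSq_eq_norm_sq (_ - _), Complex.normSq_apply]
  simp
  ring

theorem hasSum_cos_sin_sq {f : ℝ → ℝ} (hf : MemLp f 2 unitIntervalMeasure) :
    HasSum (fun i : ℤ => (∫ x in Ioo (0 : ℝ) 1, f x * Real.cos (i * (Real.pi / 2) * x)) ^ 2 +
        (∫ x in Ioo (0 : ℝ) 1, f x * Real.sin (i * (Real.pi / 2) * x)) ^ 2)
      (4 * ∫ x in Ioo (0 : ℝ) 1, f x ^ 2) := by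
  have hL : MemLp ((Ioo (0 : ℝ) 1).indicator fun x => (f x : ℂ)) 2
      (volume.restrict (Ioc (0 : ℝ) 4)) := by
    refine MemLp.restrict _ ?_
    rw [memLp_indicator_iff_restrict measurableSet_Ioo]
    exact hf.ofReal
  have h := (hasSum_sq_fourierCoeffOn (show (0 : ℝ) < 4 by norm_num) hL).mul_left 16
  simp only [norm_fourierCoeffOn_indicator_sq hf, ← mul_assoc] at h
  have hr : 16 * (4 - 0 : ℝ)⁻¹ •
      ∫ x in (0 : ℝ)..4, ‖(Ioo (0 : ℝ) 1).indicator (fun x => (f x : ℂ)) x‖ ^ 2 =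
      4 * ∫ x in Ioo (0 : ℝ) 1, f x ^ 2 := by
    rw [intervalIntegral.integral_of_le (by norm_num), ← integral_indicator measurableSet_Ioc,
      ← integral_indicator measurableSet_Ioo, smul_eq_mul, ← mul_assoc]
    congr 1
    · norm_num
    · refine integral_congr_ae (ae_of_all _ fun x => ?_)
      by_cases hx : x ∈ Ioo (0 : ℝ) 1
      · have hx' : x ∈ Ioc (0 : ℝ) 4 := ⟨hx.1, by linarith [hx.2]⟩
        simp [indicator_of_mem hx, indicator_of_mem hx']
      · simp [indicator_of_notMem hx]
  rw [hr] at h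
  norm_num only [one_mul] at h
  exact h

/-- The terms of the Fourier sum over `ℤ` are even in the index, so the negative indices `-(n + 1)`
repeat the positive ones. -/
theorem tsum_cos_sin_sq {f : ℝ → ℝ} (hf : MemLp f 2 unitIntervalMeasure) (a : ℕ → ℝ≥0∞)
    (ha : ∀ n, a n = ‖∫ x in Ioo (0 : ℝ) 1, f x * Real.cos (n * (Real.pi / 2) * x)‖ₑ ^ 2 +
        ‖∫ x in Ioo (0 : ℝ) 1, f x * Real.sin (n * (Real.pi / 2) * x)‖ₑ ^ 2) :
    ∑' n, a n + ∑' n, a (n + 1) = 4 * ∫⁻ x in Ioo (0 : ℝ) 1, ‖f x‖ₑ ^ 2 := by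
  have h := hasSum_cos_sin_sq hf
  have hpos : ∀ i : ℤ, 0 ≤ (∫ x in Ioo (0 : ℝ) 1, f x * Real.cos (i * (Real.pi / 2) * x)) ^ 2 +
        (∫ x in Ioo (0 : ℝ) 1, f x * Real.sin (i * (Real.pi / 2) * x)) ^ 2 := fun i => by positivity
  have he : ∀ r : ℝ, ENNReal.ofReal (r ^ 2) = ‖r‖ₑ ^ 2 := fun r => by
    rw [← sq_abs, ENNReal.ofReal_pow (abs_nonneg _), ← Real.norm_eq_abs, ofReal_norm]
  have hR : ENNReal.ofReal (4 * ∫ x in Ioo (0 : ℝ) 1, f x ^ 2) =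
      4 * ∫⁻ x in Ioo (0 : ℝ) 1, ‖f x‖ₑ ^ 2 := by
    rw [ENNReal.ofReal_mul (by norm_num),
      ofReal_integral_eq_lintegral_ofReal hf.integrable_sq (ae_of_all _ fun x => sq_nonneg _)]
    simp only [he]
    simp
  rw [← hR, ← h.tsum_eq, ENNReal.ofReal_tsum_of_nonneg hpos h.summable,
    tsum_of_nat_of_neg_add_one ENNReal.summable ENNReal.summable]
  congr 1
  · refine tsum_congr fun n => ?_
    rw [ENNReal.ofReal_add (sq_nonneg _) (sq_nonneg _), he, he, ha]
    simp
  · refine tsum_congr fun n => ?_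
    rw [ENNReal.ofReal_add (sq_nonneg _) (sq_nonneg _), he, he, ha]
    have e : ∀ x : ℝ, ((-((n : ℤ) + 1) : ℤ) : ℝ) * (Real.pi / 2) * x =
      -(((n + 1 : ℕ) : ℝ) * (Real.pi / 2) * x) := fun x => by push_cast; ring
    simp only [e, Real.cos_neg, Real.sin_neg, mul_neg, integral_neg, enorm_neg]

theorem tsum_dirFun_le (p q : Prop) {f : ℝ → ℝ} (hf : MemLp f 2 unitIntervalMeasure) :
    ∑' n, ‖∫ x in Ioo (0 : ℝ) 1, f x * dirFun p q n x‖ₑ ^ 2 ≤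
      ∫⁻ x in Ioo (0 : ℝ) 1, ‖f x‖ₑ ^ 2 :=
  tsum_enorm_sq_le_of_orthogonal
    (fun _ => MemLp.of_bound continuous_dirFun.aestronglyMeasurable 2
      (ae_of_all _ fun x => abs_dirFun_le x))
    (fun _ _ h => integral_dirFun_mul_dirFun h) (fun _ => integral_dirFun_sq_le) hf

theorem enorm_integral_mul_amp_sq {p q : Prop} {n : ℕ} (f g : ℝ → ℝ) :
    ‖∫ x in Ioo (0 : ℝ) 1, f x * (amp p q n * g x)‖ₑ ^ 2 =
      ‖amp p q n‖ₑ ^ 2 * ‖∫ x in Ioo (0 : ℝ) 1, f x * g x‖ₑ ^ 2 := by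
  simp only [mul_left_comm (f _), integral_const_mul, enorm_mul, mul_pow]

theorem enorm_sqrt_two_sq : ‖√2‖ₑ ^ 2 = 2 := by
  rw [← ofReal_norm, ← ENNReal.ofReal_pow (norm_nonneg _)]
  simp

/-- Even multiples of `π/2` are the frequencies for equal end conditions, odd ones those for
different end conditions. In each class one system consists of cosines and the other of sines, so
together they exhaust the Fourier sum. -/
theorem sum_tsum_dirFun {f : ℝ → ℝ} (hf : MemLp f 2 unitIntervalMeasure) :
    (∑' n, ‖∫ x in Ioo (0 : ℝ) 1, f x * dirFun False False n x‖ₑ ^ 2 +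
      ∑' n, ‖∫ x in Ioo (0 : ℝ) 1, f x * dirFun True True n x‖ₑ ^ 2) +
    (∑' n, ‖∫ x in Ioo (0 : ℝ) 1, f x * dirFun False True n x‖ₑ ^ 2 +
      ∑' n, ‖∫ x in Ioo (0 : ℝ) 1, f x * dirFun True False n x‖ₑ ^ 2) =
      4 * ∫⁻ x in Ioo (0 : ℝ) 1, ‖f x‖ₑ ^ 2 := by
  set a : ℕ → ℝ≥0∞ := fun n =>
    ‖∫ x in Ioo (0 : ℝ) 1, f x * Real.cos (n * (Real.pi / 2) * x)‖ₑ ^ 2 +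
      ‖∫ x in Ioo (0 : ℝ) 1, f x * Real.sin (n * (Real.pi / 2) * x)‖ₑ ^ 2 with ha
  rw [← tsum_cos_sin_sq hf a fun n => rfl]
  have f1 : ∀ n : ℕ, freq False False n = ((2 * n : ℕ) : ℝ) * (Real.pi / 2) := fun n => by
    simp only [freq, if_pos]; push_cast; ring
  have f2 : ∀ n : ℕ, freq True True n = ((2 * n : ℕ) : ℝ) * (Real.pi / 2) := fun n => by
    simp only [freq, if_pos]; push_cast; ring
  have f3 : ∀ n : ℕ, freq False True n = ((2 * n + 1 : ℕ) : ℝ) * (Real.pi / 2) := fun n => by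
    rw [freq, if_neg (by simp)]; push_cast; ring
  have f4 : ∀ n : ℕ, freq True False n = ((2 * n + 1 : ℕ) : ℝ) * (Real.pi / 2) := fun n => by
    rw [freq, if_neg (by simp)]; push_cast; ring
  have g1 : ∀ n, ‖amp False False n‖ₑ ^ 2 = if n = 0 then 1 else 2 := fun n => by
    rw [amp, f1]
    split_ifs with h1 h2 h2
    · simp
    · simp_all
    · simp_all
    · exact enorm_sqrt_two_sq
  have g2 : ∀ n, ‖amp True True n‖ₑ ^ 2 = if n = 0 then 1 else 2 := fun n => by
    rw [← g1, amp, amp, f1, f2]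
  have hne : ∀ n : ℕ, ((2 * n + 1 : ℕ) : ℝ) * (Real.pi / 2) ≠ 0 := fun n => by positivity
  have g3 : ∀ n, ‖amp False True n‖ₑ ^ 2 = 2 := fun n => by
    rw [amp, f3, if_neg (hne n), enorm_sqrt_two_sq]
  have g4 : ∀ n, ‖amp True False n‖ₑ ^ 2 = 2 := fun n => by
    rw [amp, f4, if_neg (hne n), enorm_sqrt_two_sq]
  simp only [dirFun, if_true, if_false, enorm_integral_mul_amp_sq, g1, g2, g3, g4, f1, f2, f3, f4]
  rw [← ENNReal.tsum_add, ← ENNReal.tsum_add]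
  simp only [← mul_add]
  have e1 : ∀ n, ((if n = 0 then 1 else 2 : ℝ≥0∞) *
      (‖∫ x in Ioo (0 : ℝ) 1, f x * Real.cos (((2 * n : ℕ) : ℝ) * (Real.pi / 2) * x)‖ₑ ^ 2 +
      ‖∫ x in Ioo (0 : ℝ) 1, f x * Real.sin (((2 * n : ℕ) : ℝ) * (Real.pi / 2) * x)‖ₑ ^ 2)) =
      (if n = 0 then 1 else 2 : ℝ≥0∞) * a (2 * n) := fun n => rfl
  have e2 : ∀ n : ℕ, ((2 : ℝ≥0∞) *
      (‖∫ x in Ioo (0 : ℝ) 1, f x * Real.cos (((2 * n + 1 : ℕ) : ℝ) * (Real.pi / 2) * x)‖ₑ ^ 2 +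
      ‖∫ x in Ioo (0 : ℝ) 1, f x * Real.sin (((2 * n + 1 : ℕ) : ℝ) * (Real.pi / 2) * x)‖ₑ ^ 2)) =
      2 * a (2 * n + 1) := fun n => rfl
  simp only [e1, e2]
  -- Index 0 occurs only in the first of the two sums and every other index in both; this matches
  -- the squared amplitudes 1 and 2.
  rw [← tsum_even_add_odd (f := a) ENNReal.summable ENNReal.summable,
    ← tsum_even_add_odd (f := fun n => a (n + 1)) ENNReal.summable ENNReal.summable,
    tsum_eq_zero_add' (f := fun n => (if n = 0 then 1 else 2 : ℝ≥0∞) * a (2 * n))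
      ENNReal.summable,
    tsum_eq_zero_add' (f := fun n => a (2 * n)) ENNReal.summable, ENNReal.tsum_mul_left]
  simp only [Nat.add_eq_zero_iff, one_ne_zero, and_false, if_false, if_true, one_mul,
    ENNReal.tsum_mul_left, mul_add, mul_one, add_assoc, mul_zero]
  ring

/-- Each of the four systems satisfies Bessel's inequality with bound `‖f‖²`, and their four sums
add up to `4‖f‖²`. Therefore none of the inequalities can be strict. -/
theorem isParsevalFrame_dirFun (p q : Prop) :
    IsParsevalFrame unitIntervalMeasure (dirFun p q) := by
  intro f hf
  have hX : ∫⁻ x in Ioo (0 : ℝ) 1, ‖f x‖ₑ ^ 2 ≠ ∞ := by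
    rw [lintegral_enorm_sq_eq hf]; exact ENNReal.pow_ne_top enorm_ne_top
  have hle := fun p q => tsum_dirFun_le p q hf
  have hs := sum_tsum_dirFun hf
  have hA := fun p q => ne_top_of_le_ne_top hX (hle p q)
  obtain ⟨A, hA'⟩ : ∃ A : Prop → Prop → NNReal, ∀ p q, (A p q : ℝ≥0∞) =
      ∑' n, ‖∫ x in Ioo (0 : ℝ) 1, f x * dirFun p q n x‖ₑ ^ 2 :=
    ⟨fun p q => (∑' n, ‖∫ x in Ioo (0 : ℝ) 1, f x * dirFun p q n x‖ₑ ^ 2).toNNReal,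
      fun p q => ENNReal.coe_toNNReal (hA p q)⟩
  lift (∫⁻ x in Ioo (0 : ℝ) 1, ‖f x‖ₑ ^ 2) to NNReal using hX with X
  simp only [← hA'] at hle hs ⊢
  norm_cast at hle hs ⊢
  have key : ∀ p q : Prop, (A p q : ℝ) ≤ X := fun p q => by exact_mod_cast hle p q
  have hs' : ((A False False : ℝ) + A True True) + (A False True + A True False) = 4 * X := by
    exact_mod_cast hs
  have k1 := key False False
  have k2 := key True True
  have k3 := key False True
  have k4 := key True False
  apply NNReal.coe_injective
  by_cases hp : p <;> by_cases hq : q <;> simp only [hp, hq] <;> linarith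

/-- Negating both conditions keeps the frequencies and turns sines into cosines, so up to sign the
`neuFun` are again a `dirFun` family and inherit its Parseval identity. -/
theorem dirFun_not (p q : Prop) (n : ℕ) :
    dirFun (¬p) (¬q) n = neuFun p q n ∨ dirFun (¬p) (¬q) n = -neuFun p q n := by
  have h : freq (¬p) (¬q) n = freq p q n := by
    by_cases hp : p <;> by_cases hq : q <;> simp [freq, hp, hq]
  have h' : amp (¬p) (¬q) n = amp p q n := by simp only [amp, h]
  by_cases hp : p
  · left
    funext x
    simp only [dirFun, neuFun, h, h', if_neg (not_not.2 hp), if_pos hp]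
  · right
    funext x
    simp only [dirFun, neuFun, h, h', if_pos hp, if_neg hp, Pi.neg_apply, mul_neg, neg_neg]

theorem isParsevalFrame_neuFun (p q : Prop) :
    IsParsevalFrame unitIntervalMeasure (neuFun p q) := by
  intro f hf
  rw [← isParsevalFrame_dirFun (¬p) (¬q) f hf]
  refine tsum_congr fun n => ?_
  rcases dirFun_not p q n with h | h <;> simp [h, integral_neg]

/-! ### Tensor products of Parseval families -/

section Tensor

variable {X Y ι κ : Type*} [MeasurableSpace X] [MeasurableSpace Y]

theorem memLp_two_iff_lintegral {μ : Measure X} {f : X → ℝ} (hf : AEStronglyMeasurable f μ) :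
    MemLp f 2 μ ↔ ∫⁻ x, ‖f x‖ₑ ^ 2 ∂μ < ∞ := by
  rw [MemLp, and_iff_right hf,
    eLpNorm_lt_top_iff_lintegral_rpow_enorm_lt_top (by norm_num) (by norm_num)]
  simp

theorem IsParsevalFrame.comp_equiv {μ : Measure X} {e : ι → X → ℝ} (he : IsParsevalFrame μ e)
    (σ : κ ≃ ι) : IsParsevalFrame μ fun k => e (σ k) := fun f hf => by
  rw [← he f hf]
  exact σ.tsum_eq fun n => ‖∫ x, f x * e n x ∂μ‖ₑ ^ 2

theorem IsParsevalFrame.comp_measurePreserving {μ : Measure X} {ν : Measure Y} {e : ι → Y → ℝ}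
    (he : IsParsevalFrame ν e) (T : X ≃ᵐ Y) (hT : MeasurePreserving T μ ν) :
    IsParsevalFrame μ fun n x => e n (T x) := fun f hf => by
  have h := he (f ∘ T.symm) (hf.comp_measurePreserving (hT.symm T))
  rw [← hT.lintegral_comp_emb T.measurableEmbedding] at h
  simp only [← hT.integral_comp T.measurableEmbedding] at h
  simpa using h

/-- Fubini: the Parseval identity in `x` holds on almost every slice. Integrating it over `y` gives
the sum of the squared norms of the coefficient functions, and to each of these the identity in `y`
applies. The uniform bound `C` keeps all integrands integrable. -/
theorem IsParsevalFrame.prod [Countable ι] [Countable κ] {μ : Measure X} {ν : Measure Y}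
    [IsFiniteMeasure μ] [IsFiniteMeasure ν] {e : ι → X → ℝ} {g : κ → Y → ℝ}
    (he : IsParsevalFrame μ e) (hg : IsParsevalFrame ν g)
    (hem : ∀ n, Measurable (e n)) (hgm : ∀ n, Measurable (g n))
    {C : ℝ} (heb : ∀ n x, |e n x| ≤ C) (hgb : ∀ n x, |g n x| ≤ C) :
    IsParsevalFrame (μ.prod ν) fun (k : ι × κ) (z : X × Y) => e k.1 z.1 * g k.2 z.2 := by
  intro f hf
  have hfi : Integrable f (μ.prod ν) := hf.integrable (by norm_num)
  have hfe : ∀ n, Integrable (fun z : X × Y => f z * e n z.1) (μ.prod ν) := fun n =>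
    hfi.mul_bdd (c := C) ((hem n).comp measurable_fst).aestronglyMeasurable
      (ae_of_all _ fun z => heb n z.1)
  have hfeg : ∀ n m, Integrable (fun z : X × Y => f z * e n z.1 * g m z.2) (μ.prod ν) :=
    fun n m => (hfe n).mul_bdd (c := C) ((hgm m).comp measurable_snd).aestronglyMeasurable
      (ae_of_all _ fun z => hgb m z.2)
  have hF : ∀ n, AEStronglyMeasurable (fun y => ∫ x, f (x, y) * e n x ∂μ) ν := fun n =>
    (hfe n).aestronglyMeasurable.prod_swap.integral_prod_right'
  have hsq : AEMeasurable (fun z => ‖f z‖ₑ ^ 2) (μ.prod ν) :=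
    hf.aestronglyMeasurable.enorm.pow_const 2
  have hfin := (memLp_two_iff_lintegral hf.aestronglyMeasurable).1 hf
  have hswap : ∫⁻ z, ‖f z‖ₑ ^ 2 ∂μ.prod ν = ∫⁻ y, ∫⁻ x, ‖f (x, y)‖ₑ ^ 2 ∂μ ∂ν :=
    lintegral_prod_symm _ hsq
  have hslice : ∀ᵐ y ∂ν, ∑' n, ‖∫ x, f (x, y) * e n x ∂μ‖ₑ ^ 2 =
      ∫⁻ x, ‖f (x, y)‖ₑ ^ 2 ∂μ := by
    have h1 : ∀ᵐ y ∂ν, ∫⁻ x, ‖f (x, y)‖ₑ ^ 2 ∂μ < ∞ :=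
      ae_lt_top' hsq.lintegral_prod_left' (by rw [← hswap]; exact hfin.ne)
    filter_upwards [h1, hf.aestronglyMeasurable.prod_swap.prodMk_left] with y h2 h3
    exact he _ ((memLp_two_iff_lintegral h3).2 h2)
  have hsum : ∑' n, ∫⁻ y, ‖∫ x, f (x, y) * e n x ∂μ‖ₑ ^ 2 ∂ν = ∫⁻ z, ‖f z‖ₑ ^ 2 ∂μ.prod ν := by
    rw [← lintegral_tsum fun n => (hF n).enorm.pow_const 2, hswap]
    exact lintegral_congr_ae hslice
  rw [← hsum, ENNReal.tsum_prod']
  refine tsum_congr fun n => ?_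
  have hn : MemLp (fun y => ∫ x, f (x, y) * e n x ∂μ) 2 ν := by
    rw [memLp_two_iff_lintegral (hF n)]
    refine lt_of_le_of_lt ?_ hfin
    rw [← hsum]
    exact ENNReal.le_tsum n
  rw [← hg _ hn]
  refine tsum_congr fun m => ?_
  simp only [← mul_assoc]
  rw [integral_prod_symm _ (hfeg n m)]
  simp only [integral_mul_const]

theorem IsParsevalFrame.pi {d : ℕ} {μ : Fin d → Measure ℝ} [∀ i, IsFiniteMeasure (μ i)]
    {e : Fin d → ℕ → ℝ → ℝ} (he : ∀ i, IsParsevalFrame (μ i) (e i))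
    (hem : ∀ i n, Measurable (e i n)) (heb : ∀ i n x, |e i n x| ≤ 2) :
    IsParsevalFrame (Measure.pi μ) fun (n : Fin d → ℕ) x => ∏ i, e i (n i) (x i) := by
  induction d with
  | zero =>
    intro f _
    rw [Measure.pi_of_empty μ default]
    simp [tsum_fintype]
  | succ d ih =>
    have h := ((he 0).prod (ih (μ := fun j => μ ((0 : Fin (d + 1)).succAbove j))
      (fun i => he ((0 : Fin (d + 1)).succAbove i)) (fun i => hem _) (fun i => heb _)) (hem 0)
      (fun n => Finset.measurable_prod _ fun i _ => (hem _ _).comp (measurable_pi_apply i))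
      -- A common bound for the single factor and for the product of the remaining `d` factors.
      (C := 2 ^ (d + 1))
      (fun n x => (heb 0 n x).trans (by
        rw [pow_succ]; nlinarith [one_le_pow₀ (n := d) (one_le_two (α := ℝ))]))
      (fun n x => by
        rw [Finset.abs_prod]
        refine (Finset.prod_le_prod (fun _ _ => abs_nonneg _) fun i _ => heb _ _ _).trans ?_
        simp [pow_succ])).comp_measurePreserving _ (measurePreserving_piFinSuccAbove μ 0)
    have h2 : (fun (n : Fin (d + 1) → ℕ) (x : Fin (d + 1) → ℝ) => ∏ i, e i (n i) (x i)) =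
        fun n => (fun (k : ℕ × (Fin d → ℕ)) (x : Fin (d + 1) → ℝ) =>
          e 0 k.1 (x 0) * ∏ i, e (Fin.succAbove 0 i) (k.2 i) (x (Fin.succAbove 0 i)))
          ((Fin.consEquiv fun _ => ℕ).symm n) := by
      funext n x
      rw [Fin.prod_univ_succAbove _ 0]
      rfl
    rw [h2]
    exact h.comp_equiv (Fin.consEquiv fun _ => ℕ).symm

end Tensor

/-! ### Transfer to the unit cube -/

/-- The unit cube in `Fin 3 → ℝ` with Lebesgue measure. -/
noncomputable abbrev cubePi : Measure (Fin 3 → ℝ) := Measure.pi fun _ => unitIntervalMeasure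

theorem unitCube_eq_preimage :
    unitCube = (MeasurableEquiv.toLp 2 (Fin 3 → ℝ)).symm ⁻¹' univ.pi fun _ => Ioo (0 : ℝ) 1 := by
  ext x
  simp [unitCube, Set.mem_pi]

theorem measurableSet_unitCube : MeasurableSet unitCube := by
  rw [unitCube_eq_preimage]
  exact (MeasurableEquiv.measurable _) (MeasurableSet.univ_pi fun _ => measurableSet_Ioo)

theorem measurePreserving_unitCube :
    MeasurePreserving (MeasurableEquiv.toLp 2 (Fin 3 → ℝ)).symm (volume.restrict unitCube)
      cubePi := by
  have h := (EuclideanSpace.volume_preserving_symm_measurableEquiv_toLp (Fin 3)).restrict_preimage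
    (s := univ.pi fun _ => Ioo (0 : ℝ) 1) (MeasurableSet.univ_pi fun _ => measurableSet_Ioo)
  rwa [← unitCube_eq_preimage, volume_pi, Measure.restrict_pi_pi] at h

instance isFiniteMeasure_unitCube : IsFiniteMeasure (volume.restrict unitCube) := by
  refine ⟨?_⟩
  have := measurePreserving_unitCube.measure_preimage MeasurableSet.univ.nullMeasurableSet
  rw [preimage_univ] at this
  rw [this]
  exact measure_lt_top _ _

theorem integral_unitCube (f : R3 → ℝ) :
    ∫ x in unitCube, f x = ∫ x, f (WithLp.toLp 2 x) ∂cubePi :=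
  measurePreserving_unitCube.integral_comp
    (MeasurableEquiv.measurableEmbedding _) fun x => f (WithLp.toLp 2 x)

theorem IsParsevalFrame.cube {e : Fin 3 → ℕ → ℝ → ℝ}
    (he : ∀ i, IsParsevalFrame unitIntervalMeasure (e i))
    (hem : ∀ i n, Measurable (e i n)) (heb : ∀ i n x, |e i n x| ≤ 2) :
    IsParsevalFrame (volume.restrict unitCube)
      fun (n : Fin 3 → ℕ) (x : R3) => ∏ i, e i (n i) (x i) := by
  have h1 : IsParsevalFrame cubePi fun (n : Fin 3 → ℕ) x => ∏ i, e i (n i) (x i) :=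
    IsParsevalFrame.pi he hem heb
  have h2 : (fun (n : Fin 3 → ℕ) (x : R3) => ∏ i, e i (n i) (x i)) =
      fun n x => ∏ i, e i (n i) ((MeasurableEquiv.toLp 2 (Fin 3 → ℝ)).symm x i) := rfl
  rw [h2]
  exact h1.comp_measurePreserving _ measurePreserving_unitCube

/-! ### Block diagonal operators and their constants -/

section Abstract

variable {H K : Type*} [NormedAddCommGroup H] [InnerProductSpace ℝ H]
  [NormedAddCommGroup K] [InnerProductSpace ℝ K]
  {ι J L : Type*} [Fintype J] [Fintype L]

/-- The closed relation `S` is block diagonal with symbols `M n` with respect to the families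
`u` and `v`, which satisfy the Parseval identity. -/
structure IsBlockDiagonal (S : Submodule ℝ (H × K)) (u : ι → J → H) (v : ι → L → K)
    (M : ι → Matrix L J ℝ) : Prop where
  parseval_left : ∀ x, ∑' n, ∑ j, ‖inner ℝ x (u n j)‖ₑ ^ 2 = ‖x‖ₑ ^ 2
  parseval_right : ∀ y, ∑' n, ∑ l, ‖inner ℝ y (v n l)‖ₑ ^ 2 = ‖y‖ₑ ^ 2
  mem : ∀ n j, (u n j, ∑ l, M n l j • v n l) ∈ S
  coeff : ∀ z ∈ S, ∀ n l, inner ℝ z.2 (v n l) = (M n).mulVec (fun j => inner ℝ z.1 (u n j)) l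

theorem eq_zero_of_parseval {u : ι → J → H}
    (hu : ∀ x, ∑' n, ∑ j, ‖inner ℝ x (u n j)‖ₑ ^ 2 = ‖x‖ₑ ^ 2) {x : H}
    (hx : ∀ n j, inner ℝ x (u n j) = 0) : x = 0 := by
  have := hu x
  simp only [hx, enorm_zero, ne_eq, OfNat.ofNat_ne_zero, not_false_eq_true, zero_pow,
    Finset.sum_const_zero, tsum_zero] at this
  exact enorm_eq_zero.1 (pow_eq_zero_iff two_ne_zero |>.1 this.symm)

theorem sum_enorm_sq (a : J → ℝ) : ∑ j, ‖a j‖ₑ ^ 2 = ENNReal.ofReal (∑ j, a j ^ 2) := by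
  rw [ENNReal.ofReal_sum_of_nonneg fun _ _ => sq_nonneg _]
  refine Finset.sum_congr rfl fun j _ => ?_
  rw [← sq_abs, ENNReal.ofReal_pow (abs_nonneg _), ← Real.norm_eq_abs, ofReal_norm]

namespace IsBlockDiagonal

variable {S : Submodule ℝ (H × K)} {u : ι → J → H} {v : ι → L → K} {M : ι → Matrix L J ℝ}

/-- This is closability: it makes the graph of `S.toLinearPMap` equal to `S`. -/
theorem single_valued (h : IsBlockDiagonal S u v M) : ∀ x ∈ S, x.1 = 0 → x.2 = 0 := by
  intro z hz h0
  refine eq_zero_of_parseval h.parseval_right fun n l => ?_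
  rw [h.coeff z hz, h0]
  simp [← Pi.zero_def]

theorem sum_mem (h : IsBlockDiagonal S u v M) (n : ι) (a : J → ℝ) :
    (∑ j, a j • u n j, ∑ l, (M n).mulVec a l • v n l) ∈ S := by
  have := S.sum_mem (t := Finset.univ) fun j _ => S.smul_mem (a j) (h.mem n j)
  convert this using 1
  refine Prod.ext (by simp [Prod.fst_sum]) ?_
  simp only [Prod.snd_sum, Prod.smul_snd, Matrix.mulVec, dotProduct, Finset.sum_smul,
    Finset.smul_sum, smul_smul]
  rw [Finset.sum_comm]
  simp only [mul_comm]

theorem mem_domain (h : IsBlockDiagonal S u v M) {x : H} {y : K} (hxy : (x, y) ∈ S) :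
    ∃ hx : x ∈ S.toLinearPMap.domain, S.toLinearPMap ⟨x, hx⟩ = y := by
  have hg := S.toLinearPMap_graph_eq h.single_valued
  rw [← hg, LinearPMap.mem_graph_iff] at hxy
  obtain ⟨z, hz, hz'⟩ := hxy
  obtain rfl : (z : H) = x := hz
  exact ⟨z.2, hz'⟩

theorem mem_graph (h : IsBlockDiagonal S u v M) (x : S.toLinearPMap.domain) :
    ((x : H), S.toLinearPMap x) ∈ S :=
  Submodule.mem_graph_toLinearPMap h.single_valued x

variable [CompleteSpace H]

theorem dense_domain (h : IsBlockDiagonal S u v M) :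
    Dense (S.toLinearPMap.domain : Set H) := by
  rw [Submodule.dense_iff_topologicalClosure_eq_top, Submodule.topologicalClosure_eq_top_iff,
    Submodule.eq_bot_iff]
  intro x hx
  refine eq_zero_of_parseval h.parseval_left fun n j => ?_
  rw [real_inner_comm]
  exact (Submodule.mem_orthogonal _ _).1 hx _ (h.mem_domain (h.mem n j)).1

/-- The range of the adjoint is orthogonal to the kernel, and orthogonality survives taking the
closure. -/
theorem inner_eq_zero_of_mem_closure (h : IsBlockDiagonal S u v M) {x : H}
    (hx : x ∈ closure (range S.toLinearPMap.adjoint)) {k : H} (hk : (k, (0 : K)) ∈ S) :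
    inner ℝ k x = 0 := by
  have hcl : IsClosed {x : H | inner ℝ k x = 0} :=
    isClosed_eq (by fun_prop) continuous_const
  refine closure_minimal ?_ hcl hx
  rintro _ ⟨y, rfl⟩
  obtain ⟨hkd, hk0⟩ := h.mem_domain hk
  have := LinearPMap.adjoint_isFormalAdjoint h.dense_domain y ⟨k, hkd⟩
  rw [hk0, inner_zero_right] at this
  change inner ℝ k _ = 0
  rw [real_inner_comm]
  exact this

/-- The infimum is computed block by block. `hlow` bounds each block from below on the coefficients
that can occur for a vector in the closure of the range of the adjoint: they are zero where `u n j`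
is, and orthogonal to the kernel of the block. `hup` supplies for each admissible block an
eigenvector of `MᵀM` with eigenvalue `r²` and nonzero image in `H`, so the bound is attained. -/
theorem poincareConst_eq [CompleteSpace K] (h : IsBlockDiagonal S u v M) (Adm : ι → Prop) (r : ι → ℝ)
    (hlow : ∀ n (a : J → ℝ), (∀ j, u n j = 0 → a j = 0) →
      (∀ k, (M n).mulVec k = 0 → k ⬝ᵥ a = 0) → a ≠ 0 →
      Adm n ∧ r n ^ 2 * ∑ j, a j ^ 2 ≤ ∑ l, (M n).mulVec a l ^ 2)
    (hup : ∀ n, Adm n → 0 < r n ∧ ∃ a : J → ℝ,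
      (M n).transpose.mulVec ((M n).mulVec a) = r n ^ 2 • a ∧ ∑ j, a j • u n j ≠ 0) :
    poincareConst S.toLinearPMap = (⨅ (n) (_ : Adm n), ENNReal.ofReal (r n))⁻¹ := by
  unfold poincareConst
  congr 1
  refine le_antisymm ?_ ?_
  · refine le_iInf₂ fun n hn => ?_
    obtain ⟨hr, a, ha, ha0⟩ := hup n hn
    set X := ∑ j, a j • u n j with hX
    set Z := ∑ l, (M n).mulVec a l • v n l with hZ
    obtain ⟨hd, hAX⟩ := h.mem_domain (h.sum_mem n a)
    -- The coefficient identity and the eigenvector equation say `A* Z = r² X` with `Z = A X`. As `r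
    -- > 0`, this puts `X` in the range of the adjoint.
    have hadj : ∀ y : S.toLinearPMap.domain,
        inner ℝ (r n ^ 2 • X) (y : H) = inner ℝ Z (S.toLinearPMap y) := by
      intro y
      have hc := h.coeff _ (h.mem_graph y) n
      set b : J → ℝ := fun j => inner ℝ (y : H) (u n j) with hb
      have e1 : inner ℝ Z (S.toLinearPMap y) = (M n).mulVec a ⬝ᵥ (M n).mulVec b := by
        rw [real_inner_comm, hZ, inner_sum]
        simp only [real_inner_smul_right, hc, dotProduct]
      have e2 : inner ℝ X (y : H) = a ⬝ᵥ b := by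
        rw [real_inner_comm, hX, inner_sum]
        simp only [real_inner_smul_right, dotProduct, hb]
      rw [e1, real_inner_smul_left, e2, Matrix.dotProduct_mulVec, ← Matrix.mulVec_transpose, ha,
        smul_dotProduct, smul_eq_mul]
    have hZd : Z ∈ S.toLinearPMap.adjoint.domain :=
      LinearPMap.mem_adjoint_domain_of_exists Z ⟨_, hadj⟩
    have hAZ : S.toLinearPMap.adjoint ⟨Z, hZd⟩ = r n ^ 2 • X :=
      LinearPMap.adjoint_apply_eq h.dense_domain ⟨Z, hZd⟩ hadj
    have hXr : X ∈ closure (range S.toLinearPMap.adjoint) := by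
      refine subset_closure ?_
      have hsm := S.toLinearPMap.adjoint.map_smul ((r n ^ 2)⁻¹) ⟨Z, hZd⟩
      rw [hAZ, smul_smul, inv_mul_cancel₀ (by positivity), one_smul] at hsm
      exact ⟨_, hsm⟩
    refine iInf_le_of_le ⟨X, hd⟩ (iInf_le_of_le ha0 (iInf_le_of_le hXr ?_))
    rw [hAX]
    change ‖Z‖ₑ / ‖X‖ₑ ≤ _
    refine ENNReal.div_le_of_le_mul ?_
    -- Testing with `X` itself gives `r² ‖X‖² = ‖Z‖²`.
    have h1 := hadj ⟨X, hd⟩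
    rw [hAX, real_inner_smul_left, real_inner_self_eq_norm_sq] at h1
    change _ = inner ℝ Z Z at h1
    rw [real_inner_self_eq_norm_sq, ← mul_pow,
      pow_left_inj₀ (by positivity) (norm_nonneg _) two_ne_zero] at h1
    rw [← ofReal_norm, ← ofReal_norm, ← h1, ENNReal.ofReal_mul hr.le]
  · refine le_iInf fun x => le_iInf fun hx0 => le_iInf fun hxr => ?_
    set m := ⨅ (n) (_ : Adm n), ENNReal.ofReal (r n) with hm
    -- Both squared norms are expanded by Parseval and compared one block at a time.
    rw [ENNReal.le_div_iff_mul_le (Or.inl (by simpa using hx0)) (Or.inl enorm_ne_top),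
      ← ENNReal.pow_le_pow_left_iff two_ne_zero, mul_pow, ← h.parseval_left, ← h.parseval_right,
      ← ENNReal.tsum_mul_left]
    refine ENNReal.tsum_le_tsum fun n => ?_
    have hc := h.coeff _ (h.mem_graph x) n
    simp only [hc]
    set b : J → ℝ := fun j => inner ℝ (x : H) (u n j) with hb
    rw [sum_enorm_sq, sum_enorm_sq]
    change m ^ 2 * ENNReal.ofReal (∑ j, b j ^ 2) ≤ _
    by_cases hb0 : b = 0
    · simp [hb0]
    obtain ⟨hn, hle⟩ := hlow n b (fun j hj => by simp [hb, hj]) (fun k hk => by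
      have h1 := h.sum_mem n k
      simp only [hk, Pi.zero_apply, zero_smul, Finset.sum_const_zero] at h1
      have h2 := h.inner_eq_zero_of_mem_closure hxr h1
      rw [real_inner_comm, inner_sum] at h2
      simp only [real_inner_smul_right] at h2
      exact h2) hb0
    have hrm : m ≤ ENNReal.ofReal (r n) := iInf₂_le n hn
    calc m ^ 2 * ENNReal.ofReal (∑ j, b j ^ 2)
        ≤ ENNReal.ofReal (r n) ^ 2 * ENNReal.ofReal (∑ j, b j ^ 2) := by gcongr
      _ = ENNReal.ofReal (r n ^ 2 * ∑ j, b j ^ 2) := by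
        rw [← ENNReal.ofReal_pow (hup n hn).1.le, ← ENNReal.ofReal_mul (sq_nonneg _)]
      _ ≤ _ := ENNReal.ofReal_le_ofReal hle

end IsBlockDiagonal

end Abstract

/-! ### Integration by parts on the cube -/

/-- The partial derivative `∂ᵢ w` of a scalar function. -/
noncomputable def partialS (w : R3 → ℝ) (i : Fin 3) (x : R3) : ℝ :=
  fderiv ℝ w x (EuclideanSpace.single i 1)

/-- Frequencies in direction `i` for Dirichlet conditions on the faces in `T`. -/
noncomputable def faceFreq (T : Set (Fin 3 × Fin 2)) (i : Fin 3) (n : ℕ) : ℝ :=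
  freq ((i, 0) ∈ T) ((i, 1) ∈ T) n

/-- The factor in direction `i` that vanishes on the faces in `T`. -/
noncomputable def faceDir (T : Set (Fin 3 × Fin 2)) (i : Fin 3) (n : ℕ) : ℝ → ℝ :=
  dirFun ((i, 0) ∈ T) ((i, 1) ∈ T) n

/-- The factor in direction `i` that vanishes on the faces not in `T`. -/
noncomputable def faceNeu (T : Set (Fin 3 × Fin 2)) (i : Fin 3) (n : ℕ) : ℝ → ℝ :=
  neuFun ((i, 0) ∈ T) ((i, 1) ∈ T) n

theorem integrable_unitCube {E : Type*} [NormedAddCommGroup E] {f : R3 → E} (hf : Continuous f) :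
    IntegrableOn f unitCube := by
  have hK : IsCompact (WithLp.toLp 2 '' (univ.pi fun _ : Fin 3 => Icc (0 : ℝ) 1)) :=
    (isCompact_univ_pi fun _ => isCompact_Icc).image (PiLp.continuous_toLp 2 _)
  refine (hf.continuousOn.integrableOn_compact hK).mono_set fun x hx => ?_
  exact ⟨x.ofLp, fun i _ => Ioo_subset_Icc_self (hx i), rfl⟩

theorem toLp_insertNth (i : Fin 3) (t : ℝ) (y : Fin 2 → ℝ) :
    (WithLp.toLp 2 (i.insertNth t y : Fin 3 → ℝ) : R3) =
      WithLp.toLp 2 (i.insertNth 0 y : Fin 3 → ℝ) + t • EuclideanSpace.single i (1 : ℝ) := by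
  ext j
  refine Fin.succAboveCases i ?_ (fun k => ?_) j
  · simp
  · simp [Fin.succAbove_ne]

theorem ae_mem_unitInterval {d : ℕ} :
    ∀ᵐ y ∂Measure.pi fun _ : Fin d => unitIntervalMeasure, ∀ j, y j ∈ Ioo (0 : ℝ) 1 := by
  have h := Measure.restrict_pi_pi (fun _ : Fin d => (volume : Measure ℝ))
    fun _ => Ioo (0 : ℝ) 1
  rw [← h]
  filter_upwards [ae_restrict_mem (MeasurableSet.univ_pi fun _ => measurableSet_Ioo)] with y hy j
  exact hy j (mem_univ j)

/-- Integration over the unit cube, direction `i` first. -/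
theorem integral_unitCube_insertNth (i : Fin 3) {f : R3 → ℝ} (hf : Continuous f) :
    ∫ x in unitCube, f x =
      ∫ y, (∫ t in Ioo (0 : ℝ) 1, f (WithLp.toLp 2 (i.insertNth t y : Fin 3 → ℝ)))
        ∂Measure.pi fun _ : Fin 2 => unitIntervalMeasure := by
  have hmp := (measurePreserving_piFinSuccAbove (fun _ : Fin 3 => unitIntervalMeasure) i).symm
  have hint : Integrable (fun z : Fin 3 → ℝ => f (WithLp.toLp 2 z)) cubePi := by
    have := (measurePreserving_unitCube.integrable_comp_emb
      (MeasurableEquiv.measurableEmbedding _) (g := fun z => f (WithLp.toLp 2 z))).1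
    exact this (integrable_unitCube hf)
  have hint2 := (hmp.integrable_comp_emb (MeasurableEquiv.measurableEmbedding _)).2 hint
  have h2 := hmp.integral_comp (MeasurableEquiv.measurableEmbedding _)
    fun z : Fin 3 → ℝ => f (WithLp.toLp 2 z)
  rw [integral_unitCube]
  refine h2.symm.trans ?_
  exact integral_prod_symm _ hint2

/-- Fubini with direction `i` innermost reduces this to the one-dimensional formula on lines; the
factors in the other directions are constant along a line and agree for `e` and `e'`. Almost every
line ends in the open faces, so vanishing of `w` there is enough. -/
theorem integral_partialS_mul {T : Set (Fin 3 × Fin 2)} {w : R3 → ℝ} (hw : ContDiff ℝ 1 w)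
    (i : Fin 3) (hT : ∀ s, (i, s) ∈ T → ∀ x ∈ cubeFace (i, s), w x = 0) (n : ℕ)
    {e e' : Fin 3 → ℝ → ℝ} (he : ∀ j, Continuous (e j)) (he' : ∀ j, Continuous (e' j))
    (hei : e i = faceNeu T i n) (hei' : e' i = faceDir T i n) (hee : ∀ j, j ≠ i → e j = e' j) :
    ∫ x in unitCube, partialS w i x * ∏ j, e j (x j) =
      faceFreq T i n * ∫ x in unitCube, w x * ∏ j, e' j (x j) := by
  have hpc : Continuous (partialS w i) :=
    (hw.continuous_fderiv (by norm_num)).clm_apply continuous_const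
  have hc1 : Continuous fun x : R3 => partialS w i x * ∏ j, e j (x j) :=
    hpc.mul (continuous_finsetProd _ fun j _ => (he j).comp (by fun_prop))
  have hc2 : Continuous fun x : R3 => w x * ∏ j, e' j (x j) :=
    hw.continuous.mul (continuous_finsetProd _ fun j _ => (he' j).comp (by fun_prop))
  rw [integral_unitCube_insertNth i hc1, integral_unitCube_insertNth i hc2, ← integral_const_mul]
  refine integral_congr_ae ?_
  filter_upwards [ae_mem_unitInterval] with y hy
  have hline : ∀ t, HasDerivAt (fun t => w (WithLp.toLp 2 (i.insertNth t y : Fin 3 → ℝ)))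
      (partialS w i (WithLp.toLp 2 (i.insertNth t y : Fin 3 → ℝ))) t := by
    intro t
    have h1 : HasDerivAt (fun t : ℝ => (WithLp.toLp 2 (i.insertNth t y : Fin 3 → ℝ) : R3))
        (EuclideanSpace.single i (1 : ℝ)) t := by
      rw [funext fun t => toLp_insertNth i t y]
      simpa using ((hasDerivAt_id t).smul_const (EuclideanSpace.single i (1 : ℝ))).const_add
        (WithLp.toLp 2 (i.insertNth 0 y : Fin 3 → ℝ))
    exact (((hw.differentiable (by norm_num)) _).hasFDerivAt).comp_hasDerivAt t h1
  have hface : ∀ s : Fin 2, (i, s) ∈ T →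
      w (WithLp.toLp 2 (i.insertNth ((s : ℕ) : ℝ) y : Fin 3 → ℝ)) = 0 := by
    intro s hs
    refine hT s hs _ ⟨by simp, fun j => ?_⟩
    refine Fin.succAboveCases i (fun h => absurd rfl h) (fun k _ => ?_) j
    simpa using hy k
  have hcont : Continuous fun t : ℝ => (WithLp.toLp 2 (i.insertNth t y : Fin 3 → ℝ) : R3) := by
    rw [funext fun t => toLp_insertNth i t y]
    fun_prop
  have key := integral_Ioo_deriv_mul_neuFun (p := (i, 0) ∈ T) (q := (i, 1) ∈ T) (n := n) hline
    (hpc.comp hcont) (fun h => by simpa using hface 0 h) (fun h => by simpa using hface 1 h)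
  have hprod : ∀ (g : Fin 3 → ℝ → ℝ) (t : ℝ),
      ∏ j, g j ((WithLp.toLp 2 (i.insertNth t y : Fin 3 → ℝ) : R3) j) =
        g i t * ∏ k, g (i.succAbove k) (y k) := fun g t => by
    rw [Fin.prod_univ_succAbove _ i]
    simp
  have hk : ∏ k, e (i.succAbove k) (y k) = ∏ k, e' (i.succAbove k) (y k) :=
    Finset.prod_congr rfl fun k _ => by rw [hee _ (Fin.succAbove_ne i k)]
  simp only [hprod, hei, hei', hk, ← mul_assoc, integral_mul_const]
  unfold faceNeu faceDir faceFreq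
  rw [key]

/-! ### Cutoffs near Dirichlet endpoints -/

section Cutoff


/-- The derivative vanishes outside `[0, 1]`. The weight is `z + 1` because `z = (k+1)²(t-s)² - 1`
will be inserted, and then `z + 1` is the square that the chain rule produces. -/
theorem exists_abs_deriv_smoothTransition_le :
    ∃ B : ℝ, 0 ≤ B ∧ ∀ z, |deriv Real.smoothTransition z| * |z + 1| ≤ B := by
  have hc : Continuous (deriv Real.smoothTransition) :=
    (Real.smoothTransition.contDiff (n := 1)).continuous_deriv (by norm_num)
  obtain ⟨B, hB⟩ := (isCompact_Icc (a := (0 : ℝ)) (b := 1)).exists_bound_of_continuousOn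
    (f := fun z => deriv Real.smoothTransition z * (z + 1)) (by fun_prop)
  have hB0 : 0 ≤ B := (norm_nonneg _).trans (hB 0 ⟨le_rfl, zero_le_one⟩)
  refine ⟨B, hB0, fun z => ?_⟩
  rw [← abs_mul]
  by_cases hz : z ∈ Icc (0 : ℝ) 1
  · exact hB z hz
  have hd : deriv Real.smoothTransition z = 0 := by
    rcases lt_or_ge z 0 with h | h
    · have : Real.smoothTransition =ᶠ[𝓝 z] fun _ => 0 := by
        filter_upwards [Iio_mem_nhds h] with y hy
        exact Real.smoothTransition.zero_of_nonpos (le_of_lt hy)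
      rw [this.deriv_eq, deriv_const]
    · have h1 : 1 < z := not_le.1 fun h1 => hz ⟨h, h1⟩
      have : Real.smoothTransition =ᶠ[𝓝 z] fun _ => 1 := by
        filter_upwards [Ioi_mem_nhds h1] with y hy
        exact Real.smoothTransition.one_of_one_le (le_of_lt hy)
      rw [this.deriv_eq, deriv_const]
  simpa [hd] using hB0

/-- A smooth cutoff that vanishes near `s` if `P`, and is `1` otherwise. -/
noncomputable def cutoff (P : Prop) (s : ℝ) (k : ℕ) (t : ℝ) : ℝ :=
  open Classical in
  if P then Real.smoothTransition (((k : ℝ) + 1) ^ 2 * (t - s) ^ 2 - 1) else 1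

variable {P : Prop} {s : ℝ} {k : ℕ} {t : ℝ}

theorem contDiff_cutoff : ContDiff ℝ (⊤ : ℕ∞) (cutoff P s k) := by
  unfold cutoff
  split_ifs
  · exact Real.smoothTransition.contDiff.comp (by fun_prop)
  · exact contDiff_const

theorem abs_cutoff_le : |cutoff P s k t| ≤ 1 := by
  unfold cutoff
  split_ifs
  · rw [abs_of_nonneg (Real.smoothTransition.nonneg _)]
    exact Real.smoothTransition.le_one _
  · simp

theorem cutoff_eq_zero (hP : P) (ht : |t - s| ≤ 1 / ((k : ℝ) + 1)) : cutoff P s k t = 0 := by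
  rw [cutoff, if_pos hP]
  refine Real.smoothTransition.zero_of_nonpos ?_
  have hk : (0 : ℝ) < k + 1 := by positivity
  have h1 : ((k : ℝ) + 1) * |t - s| ≤ 1 := by
    rw [le_div_iff₀ hk] at ht
    linarith
  have h2 := pow_le_one₀ (n := 2) (by positivity) h1
  rw [mul_pow, sq_abs] at h2
  linarith

theorem eventually_cutoff_eq (ht : t ≠ s) :
    ∀ᶠ k in atTop, cutoff P s k =ᶠ[𝓝 t] fun _ => 1 := by
  by_cases hP : P
  swap
  · exact Eventually.of_forall fun k => Eventually.of_forall fun y => by simp [cutoff, hP]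
  have hd : 0 < |t - s| / 2 := half_pos (abs_pos.2 (sub_ne_zero.2 ht))
  obtain ⟨N, hN⟩ := exists_nat_gt (2 / (|t - s| / 2))
  filter_upwards [eventually_ge_atTop N] with k hk
  filter_upwards [Metric.ball_mem_nhds t hd] with y hy
  rw [cutoff, if_pos hP]
  refine Real.smoothTransition.one_of_one_le ?_
  rw [Metric.mem_ball, Real.dist_eq] at hy
  have h1 : |t - s| / 2 ≤ |y - s| := by
    have := abs_sub_le t y s
    rw [abs_sub_comm t y] at this
    linarith
  have h2 : 2 ≤ ((k : ℝ) + 1) * |y - s| := by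
    have h3 : (N : ℝ) ≤ k := by exact_mod_cast hk
    rw [div_lt_iff₀ hd] at hN
    nlinarith
  have h4 := mul_self_le_mul_self zero_le_two h2
  have h5 : ((k : ℝ) + 1) * |y - s| * (((k : ℝ) + 1) * |y - s|) =
      ((k : ℝ) + 1) ^ 2 * (y - s) ^ 2 := by
    rw [← sq_abs (y - s)]; ring
  linarith

/-- Scale invariance: the derivative grows like `k`, but only where `|t - s|` is of order `1/k`. The
weighted bound is thus uniform in `k`; the factor 2 comes from differentiating the square. -/
theorem exists_abs_deriv_cutoff_le :
    ∃ B : ℝ, 0 ≤ B ∧ ∀ (P : Prop) (s : ℝ) (k : ℕ) (t : ℝ),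
      |deriv (cutoff P s k) t| * |t - s| ≤ B := by
  obtain ⟨B, hB0, hB⟩ := exists_abs_deriv_smoothTransition_le
  refine ⟨2 * B, by positivity, fun P s k t => ?_⟩
  by_cases hP : P
  swap
  · have : cutoff P s k = fun _ => 1 := by funext y; simp [cutoff, hP]
    rw [this, deriv_const]
    simpa using hB0
  have h0 : cutoff P s k = fun t =>
      Real.smoothTransition (((k : ℝ) + 1) ^ 2 * (t - s) ^ 2 - 1) := by
    funext y; simp [cutoff, hP]
  have h1 : HasDerivAt (fun t : ℝ => ((k : ℝ) + 1) ^ 2 * (t - s) ^ 2 - 1)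
      (((k : ℝ) + 1) ^ 2 * (2 * (t - s))) t := by
    have := ((((hasDerivAt_id t).sub_const s).pow 2).const_mul (((k : ℝ) + 1) ^ 2)).sub_const 1
    simpa using this
  have h2 := ((Real.smoothTransition.contDiff (n := 1)).differentiable (by norm_num)
    (((k : ℝ) + 1) ^ 2 * (t - s) ^ 2 - 1)).hasDerivAt.comp t h1
  rw [h0]
  change |deriv (Real.smoothTransition ∘ fun t : ℝ => ((k : ℝ) + 1) ^ 2 * (t - s) ^ 2 - 1) t| *
    |t - s| ≤ _
  rw [h2.deriv]
  have h3 := hB (((k : ℝ) + 1) ^ 2 * (t - s) ^ 2 - 1)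
  rw [sub_add_cancel, abs_of_nonneg (by positivity : 0 ≤ ((k : ℝ) + 1) ^ 2 * (t - s) ^ 2)] at h3
  rw [abs_mul, abs_mul, abs_mul, abs_of_nonneg (by positivity : 0 ≤ ((k : ℝ) + 1) ^ 2),
    abs_of_nonneg (zero_le_two (α := ℝ))]
  have h4 : |t - s| * |t - s| = (t - s) ^ 2 := by rw [← sq_abs]; ring
  calc _ = 2 * (|deriv Real.smoothTransition (((k : ℝ) + 1) ^ 2 * (t - s) ^ 2 - 1)| *
        (((k : ℝ) + 1) ^ 2 * (|t - s| * |t - s|))) := by ring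
    _ ≤ 2 * B := by rw [h4]; linarith

/-- A smooth compactly supported function equal to `1` near the unit interval. -/
noncomputable def plateau : ContDiffBump (1 / 2 : ℝ) := ⟨1, 2, one_pos, one_lt_two⟩

theorem plateau_eventuallyEq (ht : t ∈ Ioo (0 : ℝ) 1) : plateau =ᶠ[𝓝 t] fun _ => 1 := by
  filter_upwards [isOpen_Ioo.mem_nhds ht] with y hy
  refine plateau.one_of_mem_closedBall ?_
  rw [mem_closedBall_iff_norm, Real.norm_eq_abs, abs_le]
  change -1 ≤ _ ∧ _ ≤ (1 : ℝ)
  constructor <;> linarith [hy.1, hy.2]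

/-- Smooth approximations of `f` that vanish near `0` if `p` and near `1` if `q`. -/
noncomputable def approx (p q : Prop) (f : ℝ → ℝ) (k : ℕ) (t : ℝ) : ℝ :=
  plateau t * (cutoff p 0 k t * cutoff q 1 k t * f t)

variable {p q : Prop} {f : ℝ → ℝ} {A : ℝ}

theorem contDiff_approx (hf : ContDiff ℝ (⊤ : ℕ∞) f) : ContDiff ℝ (⊤ : ℕ∞) (approx p q f k) :=
  plateau.contDiff.mul ((contDiff_cutoff.mul contDiff_cutoff).mul hf)

theorem approx_eq_zero_of_far (ht : 2 ≤ |t - 1 / 2|) : approx p q f k t = 0 := by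
  have : plateau t = 0 := plateau.zero_of_le_dist (by rw [Real.dist_eq]; exact ht)
  rw [approx, this, zero_mul]

theorem approx_eq_zero_left (hp : p) (ht : |t - 0| ≤ 1 / ((k : ℝ) + 1)) :
    approx p q f k t = 0 := by
  simp [approx, cutoff_eq_zero hp ht]

theorem approx_eq_zero_right (hq : q) (ht : |t - 1| ≤ 1 / ((k : ℝ) + 1)) :
    approx p q f k t = 0 := by
  simp [approx, cutoff_eq_zero hq ht]

theorem abs_approx_le (hf : ∀ t, |f t| ≤ A) : |approx p q f k t| ≤ A := by
  rw [approx, abs_mul, abs_mul, abs_mul, abs_of_nonneg plateau.nonneg]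
  have h1 := mul_le_one₀ (abs_cutoff_le (P := p) (s := 0) (k := k) (t := t)) (abs_nonneg _)
    (abs_cutoff_le (P := q) (s := 1) (k := k) (t := t))
  have h2 := mul_le_mul h1 (hf t) (abs_nonneg _) zero_le_one
  have h3 := mul_le_mul (plateau.le_one (x := t)) h2 (by positivity) zero_le_one
  simpa using h3

theorem eventually_approx_eq (ht : t ∈ Ioo (0 : ℝ) 1) :
    ∀ᶠ k in atTop, approx p q f k =ᶠ[𝓝 t] f := by
  filter_upwards [eventually_cutoff_eq (P := p) (ne_of_gt ht.1),
    eventually_cutoff_eq (P := q) (ne_of_lt ht.2)] with k h0 h1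
  filter_upwards [h0, h1, plateau_eventuallyEq ht] with y e0 e1 e2
  simp [approx, e0, e1, e2]

/-- In the product rule the dangerous terms are `cutoff' * f`. Where a cutoff is active `f` vanishes
at the endpoint, hence `|f t| ≤ A |t - s|`, and this compensates the growth of `cutoff'`. On `(0,1)`
the plateau is locally 1 and does not contribute. -/
theorem exists_abs_deriv_approx_le {f' : ℝ → ℝ} (hf : ∀ t, HasDerivAt f (f' t) t)
    (hA : ∀ t, |f t| ≤ A) (hA' : ∀ t, |f' t| ≤ A) (h0 : p → f 0 = 0) (h1 : q → f 1 = 0) :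
    ∃ C, ∀ k, ∀ t ∈ Ioo (0 : ℝ) 1, |deriv (approx p q f k) t| ≤ C := by
  obtain ⟨B, hB0, hB⟩ := exists_abs_deriv_cutoff_le
  have hA0 : 0 ≤ A := (abs_nonneg _).trans (hA 0)
  have hlip : ∀ s t, |f t - f s| ≤ A * |t - s| := fun s t =>
    convex_univ.norm_image_sub_le_of_norm_hasDerivWithin_le
      (fun x _ => (hf x).hasDerivWithinAt) (fun x _ => hA' x) (mem_univ s) (mem_univ t)
  have hcut : ∀ (P : Prop) (s : ℝ) (k : ℕ) (t : ℝ), (P → f s = 0) →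
      |deriv (cutoff P s k) t| * |f t| ≤ A * B := by
    intro P s k t hs
    by_cases hP : P
    · have h2 := hlip s t
      rw [hs hP, sub_zero] at h2
      calc _ ≤ |deriv (cutoff P s k) t| * (A * |t - s|) := by gcongr
        _ = A * (|deriv (cutoff P s k) t| * |t - s|) := by ring
        _ ≤ A * B := by gcongr; exact hB P s k t
    · have : cutoff P s k = fun _ => 1 := by funext y; simp [cutoff, hP]
      rw [this, deriv_const, abs_zero, zero_mul]
      positivity
  refine ⟨A * B + A * B + A, fun k t ht => ?_⟩
  have hev : approx p q f k =ᶠ[𝓝 t] fun t => cutoff p 0 k t * cutoff q 1 k t * f t := by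
    filter_upwards [plateau_eventuallyEq ht] with y hy
    rw [approx, hy, one_mul]
  have d0 := ((contDiff_cutoff (P := p) (s := 0) (k := k)).differentiable (by simp) t).hasDerivAt
  have d1 := ((contDiff_cutoff (P := q) (s := 1) (k := k)).differentiable (by simp) t).hasDerivAt
  have hd := (d0.mul d1).mul (hf t)
  rw [hev.deriv_eq]
  refine (congrArg abs hd.deriv).trans_le ?_
  have e0 := hcut p 0 k t h0
  have e1 := hcut q 1 k t h1
  have c0 := abs_cutoff_le (P := p) (s := 0) (k := k) (t := t)
  have c1 := abs_cutoff_le (P := q) (s := 1) (k := k) (t := t)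
  simp only [Pi.mul_apply]
  rw [add_mul]
  refine (abs_add_three _ _ _).trans (add_le_add_three ?_ ?_ ?_)
  · rw [abs_mul, abs_mul, mul_right_comm]
    exact (mul_le_mul e0 c1 (abs_nonneg _) (by positivity)).trans (by simp)
  · rw [abs_mul, abs_mul, mul_assoc]
    exact (mul_le_mul c0 e1 (by positivity) zero_le_one).trans (by simp)
  · rw [abs_mul, abs_mul]
    exact (mul_le_mul (mul_le_one₀ c0 (abs_nonneg _) c1) (hA' t) (abs_nonneg _)
      zero_le_one).trans (by simp)

end Cutoff

/-! ### Product functions and bounded convergence in `L²` -/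

/-- `Γ` is a boundary part that contains the open faces in `T` and is contained in the planes of
these faces. -/
structure IsFaceBoundary (T : Set (Fin 3 × Fin 2)) (Γ : Set R3) : Prop where
  cubeFace_subset : ∀ p ∈ T, cubeFace p ⊆ Γ
  subset_planes : ∀ y ∈ Γ, ∃ p ∈ T, y p.1 = ((p.2 : ℕ) : ℝ)

theorem IsTest.eq_zero {V : Type*} [NormedAddCommGroup V] [NormedSpace ℝ V] {Γ : Set R3}
    {φ : R3 → V} (hφ : IsTest Γ φ) {x : R3} (hx : x ∈ Γ) : φ x = 0 := by
  by_contra h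
  obtain ⟨δ, hδ, hd⟩ := hφ.dist_pos
  have := hd x (subset_tsupport _ h) x hx
  rw [dist_self] at this
  linarith

/-- A product of functions of the three coordinates. -/
noncomputable def prodFun (e : Fin 3 → ℝ → ℝ) (x : R3) : ℝ := ∏ j, e j (x j)

section Product

variable {e : Fin 3 → ℝ → ℝ} {i : Fin 3} {x : R3}

theorem contDiff_prodFun (he : ∀ j, ContDiff ℝ (⊤ : ℕ∞) (e j)) :
    ContDiff ℝ (⊤ : ℕ∞) (prodFun e) :=
  contDiff_prod fun j _ => (he j).comp (by fun_prop)

theorem partialS_prodFun (he : ∀ j, ContDiff ℝ (⊤ : ℕ∞) (e j)) :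
    partialS (prodFun e) i x = prodFun (Function.update e i (deriv (e i))) x := by
  have hd : DifferentiableAt ℝ (prodFun e) x := (contDiff_prodFun he).differentiable (by simp) x
  rw [partialS, ← hd.lineDeriv_eq_fderiv, lineDeriv]
  have h1 : ∀ t : ℝ, prodFun e (x + t • EuclideanSpace.single i 1) =
      e i (x i + t) * ∏ k, e (i.succAbove k) (x (i.succAbove k)) := fun t => by
    rw [prodFun, Fin.prod_univ_succAbove _ i]
    simp [Fin.succAbove_ne]
  have h2 : HasDerivAt (fun t => e i (x i + t)) (deriv (e i) (x i)) 0 := by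
    have h3 : HasDerivAt (e i) (deriv (e i) (x i)) (x i + 0) := by
      rw [add_zero]
      exact ((he i).differentiable (by simp) _).hasDerivAt
    exact h3.comp_const_add (x i) 0
  simp only [h1]
  rw [(h2.mul_const _).deriv, prodFun, Fin.prod_univ_succAbove _ i]
  simp [Fin.succAbove_ne]

theorem abs_prodFun_le {C : ℝ} (he : ∀ j, |e j (x j)| ≤ C) : |prodFun e x| ≤ C ^ 3 := by
  rw [prodFun, Finset.abs_prod]
  exact (Finset.prod_le_prod (fun _ _ => abs_nonneg _) fun j _ => he j).trans (by simp)

theorem prodFun_update_mul (c : ℝ) (f : ℝ → ℝ) :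
    prodFun (Function.update e i fun t => c * f t) x = c * prodFun (Function.update e i f) x := by
  rw [prodFun, prodFun, Fin.prod_univ_succAbove _ i, Fin.prod_univ_succAbove _ i]
  simp [Fin.succAbove_ne, mul_assoc]

end Product

theorem norm_R3_le {C : ℝ} {x : R3} (h : ∀ i, |x i| ≤ C) : ‖x‖ ≤ 2 * C := by
  have hC : 0 ≤ C := (abs_nonneg _).trans (h 0)
  rw [EuclideanSpace.norm_eq]
  refine Real.sqrt_le_iff.2 ⟨by positivity, ?_⟩
  have : ∀ i, ‖x i‖ ^ 2 ≤ C ^ 2 := fun i => pow_le_pow_left₀ (norm_nonneg _) (h i) 2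
  rw [Fin.sum_univ_three]
  nlinarith [this 0, this 1, this 2, sq_nonneg C]

theorem memLp_unitCube {E : Type*} [NormedAddCommGroup E] {f : R3 → E} (hf : Continuous f) :
    MemLp f 2 (volume.restrict unitCube) := by
  have hK : IsCompact (WithLp.toLp 2 '' (univ.pi fun _ : Fin 3 => Icc (0 : ℝ) 1)) :=
    (isCompact_univ_pi fun _ => isCompact_Icc).image (PiLp.continuous_toLp 2 _)
  obtain ⟨C, hC⟩ := hK.exists_bound_of_continuousOn hf.continuousOn
  refine MemLp.of_bound (integrable_unitCube hf).aestronglyMeasurable C ?_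
  filter_upwards [ae_restrict_mem measurableSet_unitCube] with x hx
  exact hC x ⟨x.ofLp, fun i _ => Ioo_subset_Icc_self (hx i), rfl⟩

/-- Dominated convergence on a set of finite measure. Uniform bounds and pointwise stabilization
thus replace any estimate of rates for the cutoffs. -/
theorem tendsto_toLp_unitCube {E : Type*} [NormedAddCommGroup E] {f : ℕ → R3 → E} {g : R3 → E}
    (hf : ∀ k, MemLp (f k) 2 (volume.restrict unitCube))
    (hg : MemLp g 2 (volume.restrict unitCube)) {C : ℝ}
    (hb : ∀ k, ∀ x ∈ unitCube, ‖f k x‖ ≤ C)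
    (hev : ∀ x ∈ unitCube, ∀ᶠ k in atTop, f k x = g x) :
    Tendsto (fun k => (hf k).toLp (f k)) atTop (𝓝 (hg.toLp g)) := by
  rw [Lp.tendsto_Lp_iff_tendsto_eLpNorm'' f hf g hg]
  simp only [eLpNorm_eq_lintegral_rpow_enorm_toReal (two_ne_zero (α := ℝ≥0∞)) ENNReal.ofNat_ne_top]
  have hgb : ∀ x ∈ unitCube, ‖g x‖ ≤ C := fun x hx => by
    obtain ⟨k, hk⟩ := (hev x hx).exists
    rw [← hk]
    exact hb k x hx
  have key : Tendsto (fun k => ∫⁻ x in unitCube, ‖(f k - g) x‖ₑ ^ (2 : ℝ≥0∞).toReal) atTop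
      (𝓝 (∫⁻ x in unitCube, 0)) := by
    refine tendsto_lintegral_of_dominated_convergence' (fun _ => ENNReal.ofReal (C + C) ^ (2 : ℝ))
      (fun k => (((hf k).sub hg).aestronglyMeasurable.enorm.pow_const _)) (fun k => ?_) ?_ ?_
    · filter_upwards [ae_restrict_mem measurableSet_unitCube] with x hx
      rw [ENNReal.toReal_ofNat]
      gcongr
      rw [← ofReal_norm]
      exact ENNReal.ofReal_le_ofReal ((norm_sub_le _ _).trans (add_le_add (hb k x hx) (hgb x hx)))
    · rw [lintegral_const]
      exact ENNReal.mul_ne_top (ENNReal.rpow_ne_top_of_nonneg (by norm_num) ENNReal.ofReal_ne_top)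
        (measure_ne_top _ _)
    · filter_upwards [ae_restrict_mem measurableSet_unitCube] with x hx
      refine tendsto_const_nhds.congr' ?_
      filter_upwards [hev x hx] with k hk
      simp [hk]
  have h2 := (ENNReal.continuous_rpow_const (y := 1 / (2 : ℝ≥0∞).toReal)).tendsto _ |>.comp key
  simpa [Function.comp_def] using h2

/-! ### Product eigenfunctions and their approximation by test functions -/

section Mix

variable {T : Set (Fin 3 × Fin 2)} {Γ : Set R3} {B : Finset (Fin 3)} {n : Fin 3 → ℕ} {k : ℕ}
  {i j : Fin 3} {x : R3}

/-- The one-dimensional factors of `mix`. -/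
noncomputable def mixFactor (T : Set (Fin 3 × Fin 2)) (B : Finset (Fin 3)) (n : Fin 3 → ℕ)
    (j : Fin 3) : ℝ → ℝ :=
  if j ∈ B then faceNeu T j (n j) else faceDir T j (n j)

/-- The product eigenfunction with factors `faceNeu` in the directions in `B` and `faceDir` in
the other ones. -/
noncomputable def mix (T : Set (Fin 3 × Fin 2)) (B : Finset (Fin 3)) (n : Fin 3 → ℕ) : R3 → ℝ :=
  prodFun (mixFactor T B n)

/-- Test functions approximating `mix`. -/
noncomputable def mixApprox (T : Set (Fin 3 × Fin 2)) (B : Finset (Fin 3)) (n : Fin 3 → ℕ)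
    (k : ℕ) : R3 → ℝ :=
  prodFun fun j => approx ((j, 0) ∈ T) ((j, 1) ∈ T) (mixFactor T B n j) k

theorem contDiff_mixFactor : ContDiff ℝ (⊤ : ℕ∞) (mixFactor T B n j) := by
  unfold mixFactor
  split_ifs
  · exact contDiff_neuFun
  · exact contDiff_dirFun

theorem abs_mixFactor_le (t : ℝ) : |mixFactor T B n j t| ≤ 2 := by
  unfold mixFactor
  split_ifs
  · exact abs_neuFun_le t
  · exact abs_dirFun_le t

theorem contDiff_mix : ContDiff ℝ (⊤ : ℕ∞) (mix T B n) :=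
  contDiff_prodFun fun _ => contDiff_mixFactor

theorem continuous_mix : Continuous (mix T B n) := contDiff_mix.continuous

theorem contDiff_mixApprox : ContDiff ℝ (⊤ : ℕ∞) (mixApprox T B n k) :=
  contDiff_prodFun fun _ => contDiff_approx contDiff_mixFactor

theorem mixApprox_eq_zero_of_near {p : Fin 3 × Fin 2} (hp : p ∈ T)
    (hx : |x p.1 - ((p.2 : ℕ) : ℝ)| ≤ 1 / ((k : ℝ) + 1)) : mixApprox T B n k x = 0 := by
  obtain ⟨j, s⟩ := p
  unfold mixApprox prodFun
  refine Finset.prod_eq_zero (Finset.mem_univ j) ?_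
  fin_cases s
  · exact approx_eq_zero_left hp (by simpa using hx)
  · exact approx_eq_zero_right hp (by simpa using hx)

theorem hasCompactSupport_mixApprox : HasCompactSupport (mixApprox T B n k) := by
  have hK : IsCompact (WithLp.toLp 2 '' (univ.pi fun _ : Fin 3 => Metric.closedBall (1 / 2 : ℝ) 2)) :=
    (isCompact_univ_pi fun _ => isCompact_closedBall _ _).image (PiLp.continuous_toLp 2 _)
  refine HasCompactSupport.intro hK fun x hx => ?_
  by_contra h
  refine hx ⟨x.ofLp, fun j _ => ?_, rfl⟩
  by_contra hj
  refine h ?_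
  unfold mixApprox prodFun
  refine Finset.prod_eq_zero (Finset.mem_univ j) (approx_eq_zero_of_far ?_)
  rw [mem_closedBall_iff_norm, not_le, Real.norm_eq_abs] at hj
  exact hj.le

/-- The approximation vanishes within `1/(k+1)` of each plane of a face in `T`. Points of `Γ` lie in
such planes, and a coordinate difference is at most the distance. -/
theorem isTest_mixApprox (hΓ : IsFaceBoundary T Γ) : IsTest Γ (mixApprox T B n k) where
  smooth := contDiff_mixApprox
  compact := hasCompactSupport_mixApprox
  dist_pos := by
    refine ⟨1 / ((k : ℝ) + 1), by positivity, fun x hx y hy => ?_⟩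
    obtain ⟨p, hp, hyp⟩ := hΓ.subset_planes y hy
    have hcl : IsClosed {x : R3 | 1 / ((k : ℝ) + 1) ≤ |x p.1 - ((p.2 : ℕ) : ℝ)|} :=
      isClosed_le continuous_const (by fun_prop)
    have hx' : 1 / ((k : ℝ) + 1) ≤ |x p.1 - ((p.2 : ℕ) : ℝ)| := by
      refine closure_minimal (fun z hz => ?_) hcl hx
      by_contra h
      exact hz (mixApprox_eq_zero_of_near hp (le_of_lt (not_le.1 h)))
    rw [← hyp] at hx'
    rw [dist_eq_norm]
    exact hx'.trans (PiLp.norm_apply_le (x - y) p.1)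

theorem eventually_mixApprox_eq (hx : x ∈ unitCube) :
    ∀ᶠ k in atTop, mixApprox T B n k =ᶠ[𝓝 x] mix T B n := by
  have h : ∀ j, ∀ᶠ k in atTop, (fun y : R3 => approx ((j, 0) ∈ T) ((j, 1) ∈ T)
      (mixFactor T B n j) k (y j)) =ᶠ[𝓝 x] fun y => mixFactor T B n j (y j) := fun j => by
    filter_upwards [eventually_approx_eq (p := (j, 0) ∈ T) (q := (j, 1) ∈ T)
      (f := mixFactor T B n j) (hx j)] with k hk
    have hc : Continuous fun y : R3 => y j := by fun_prop
    exact hc.continuousAt.eventually hk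
  filter_upwards [eventually_all.2 h] with k hk
  filter_upwards [eventually_all.2 hk] with y hy
  unfold mixApprox mix prodFun
  exact Finset.prod_congr rfl fun j _ => hy j

theorem abs_mixApprox_le : |mixApprox T B n k x| ≤ 2 ^ 3 :=
  abs_prodFun_le fun _ => abs_approx_le abs_mixFactor_le

/-- The condition `i ∉ B` is essential: the factor being differentiated must vanish at the Dirichlet
ends. Factors `faceNeu` are cut off as well, but only their size matters here. -/
theorem exists_abs_partialS_mixApprox_le (hi : i ∉ B) :
    ∃ C, ∀ k, ∀ x ∈ unitCube, |partialS (mixApprox T B n k) i x| ≤ C := by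
  have hm : mixFactor T B n i = dirFun ((i, 0) ∈ T) ((i, 1) ∈ T) (n i) := if_neg hi
  have hω : 0 ≤ freq ((i, 0) ∈ T) ((i, 1) ∈ T) (n i) := freq_nonneg
  obtain ⟨C, hC⟩ := exists_abs_deriv_approx_le (p := (i, 0) ∈ T) (q := (i, 1) ∈ T)
    (f := mixFactor T B n i) (A := 2 + freq ((i, 0) ∈ T) ((i, 1) ∈ T) (n i) * 2)
    (by rw [hm]; exact hasDerivAt_dirFun)
    (fun t => (abs_mixFactor_le t).trans (by linarith))
    (fun t => by
      rw [abs_mul, abs_of_nonneg hω]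
      have := mul_le_mul_of_nonneg_left (abs_neuFun_le (p := (i, 0) ∈ T) (q := (i, 1) ∈ T)
        (n := n i) t) hω
      linarith)
    (by rw [hm]; exact dirFun_zero) (by rw [hm]; exact dirFun_one)
  refine ⟨max C 2 ^ 3, fun k x hx => ?_⟩
  rw [mixApprox, partialS_prodFun fun _ => contDiff_approx contDiff_mixFactor]
  refine abs_prodFun_le fun j => ?_
  by_cases hj : j = i
  · subst hj
    simpa using Or.inl (hC k _ (hx j))
  · rw [Function.update_of_ne hj]
    exact (abs_approx_le abs_mixFactor_le).trans (le_max_right _ _)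

theorem partialS_mix (hi : i ∉ B) :
    partialS (mix T B n) i x = faceFreq T i (n i) * mix T (insert i B) n x := by
  have hm : mixFactor T B n i = dirFun ((i, 0) ∈ T) ((i, 1) ∈ T) (n i) := if_neg hi
  have hd : deriv (mixFactor T B n i) = fun t => faceFreq T i (n i) * faceNeu T i (n i) t := by
    funext t
    rw [hm, (hasDerivAt_dirFun t).deriv]
    rfl
  rw [mix, partialS_prodFun fun _ => contDiff_mixFactor, hd, prodFun_update_mul, mix]
  congr 2
  funext j
  by_cases hj : j = i
  · subst hj
    simp [mixFactor]
  · rw [Function.update_of_ne hj]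
    simp [mixFactor, hj]

theorem integral_partialS_mul_mix {w : R3 → ℝ} (hw : ContDiff ℝ 1 w)
    (hT : ∀ s, (i, s) ∈ T → ∀ x ∈ cubeFace (i, s), w x = 0) (hi : i ∉ B) :
    ∫ x in unitCube, partialS w i x * mix T (insert i B) n x =
      faceFreq T i (n i) * ∫ x in unitCube, w x * mix T B n x :=
  integral_partialS_mul hw i hT (n i) (fun _ => contDiff_mixFactor.continuous)
    (fun _ => contDiff_mixFactor.continuous) (by simp [mixFactor]) (if_neg hi)
    fun j hj => by simp [mixFactor, hj]

theorem isParsevalFrame_mix (T : Set (Fin 3 × Fin 2)) (B : Finset (Fin 3)) :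
    IsParsevalFrame (volume.restrict unitCube) (mix T B) := by
  refine IsParsevalFrame.cube
    (e := fun j m => if j ∈ B then faceNeu T j m else faceDir T j m) (fun j => ?_) (fun j m => ?_)
    (fun j m t => ?_)
  · split_ifs
    · exact isParsevalFrame_neuFun _ _
    · exact isParsevalFrame_dirFun _ _
  · split_ifs
    · exact continuous_neuFun.measurable
    · exact continuous_dirFun.measurable
  · split_ifs
    · exact abs_neuFun_le t
    · exact abs_dirFun_le t

end Mix

/-! ### Gradient and rotation as block diagonal operators -/

/-- The vector field with component `f` in direction `l` and zero otherwise. -/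
noncomputable def compField (f : R3 → ℝ) (l : Fin 3) (x : R3) : R3 :=
  f x • EuclideanSpace.single l (1 : ℝ)

section Fields

variable {T : Set (Fin 3 × Fin 2)} {Γ : Set R3} {f : R3 → ℝ} {l : Fin 3}

theorem compField_apply (i : Fin 3) (x : R3) :
    compField f l x i = if i = l then f x else 0 := by
  simp [compField]

theorem continuous_compField (hf : Continuous f) : Continuous (compField f l) :=
  hf.smul continuous_const

theorem norm_compField (x : R3) : ‖compField f l x‖ = |f x| := by
  simp [compField, norm_smul]

/-- The function `mix T B n` as an element of `L²`. -/
noncomputable def mixLp (T : Set (Fin 3 × Fin 2)) (B : Finset (Fin 3)) (n : Fin 3 → ℕ) :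
    L2s unitCube :=
  (memLp_unitCube (continuous_mix (T := T) (B := B) (n := n))).toLp _

/-- The field with component `mix T B n` in direction `l` as an element of `L²`. -/
noncomputable def mixFieldLp (T : Set (Fin 3 × Fin 2)) (B : Finset (Fin 3)) (n : Fin 3 → ℕ)
    (l : Fin 3) : L2v unitCube :=
  (memLp_unitCube (continuous_compField (l := l)
    (continuous_mix (T := T) (B := B) (n := n)))).toLp _

theorem inner_mixLp {B : Finset (Fin 3)} {n : Fin 3 → ℕ} {y : L2s unitCube} {g : R3 → ℝ}
    (hy : y =ᵐ[volume.restrict unitCube] g) :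
    inner ℝ y (mixLp T B n) = ∫ x in unitCube, g x * mix T B n x := by
  rw [L2.inner_def]
  refine integral_congr_ae ?_
  filter_upwards [hy, MemLp.coeFn_toLp (memLp_unitCube
    (continuous_mix (T := T) (B := B) (n := n)))] with x h1 h2
  rw [h1, mixLp, h2]
  simp [mul_comm]

theorem inner_mixFieldLp {B : Finset (Fin 3)} {n : Fin 3 → ℕ} {y : L2v unitCube} {g : R3 → R3}
    (hy : y =ᵐ[volume.restrict unitCube] g) :
    inner ℝ y (mixFieldLp T B n l) = ∫ x in unitCube, g x l * mix T B n x := by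
  rw [L2.inner_def]
  refine integral_congr_ae ?_
  filter_upwards [hy, MemLp.coeFn_toLp (memLp_unitCube (continuous_compField (l := l)
    (continuous_mix (T := T) (B := B) (n := n))))] with x h1 h2
  rw [h1, mixFieldLp, h2, compField, real_inner_smul_right, EuclideanSpace.inner_single_right]
  simp [mul_comm]

theorem parseval_mixLp (T : Set (Fin 3 × Fin 2)) (B : Finset (Fin 3)) (y : L2s unitCube) :
    ∑' n, ‖inner ℝ y (mixLp T B n)‖ₑ ^ 2 = ‖y‖ₑ ^ 2 := by
  simp only [inner_mixLp (Filter.EventuallyEq.refl _ (y : R3 → ℝ))]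
  rw [isParsevalFrame_mix T B _ (Lp.memLp y), lintegral_enorm_sq_eq (Lp.memLp y), Lp.toLp_coeFn]

theorem enorm_sq_R3 (x : R3) : ‖x‖ₑ ^ 2 = ∑ l, ‖x l‖ₑ ^ 2 := by
  rw [sum_enorm_sq, ← ofReal_norm, ← ENNReal.ofReal_pow (norm_nonneg _),
    EuclideanSpace.norm_sq_eq]
  simp

/-- The scalar Parseval identity is applied to each component separately, so every component may use
its own set `B l` of exchanged directions. -/
theorem parseval_mixFieldLp (T : Set (Fin 3 × Fin 2)) (B : Fin 3 → Finset (Fin 3))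
    (y : L2v unitCube) :
    ∑' n, ∑ l, ‖inner ℝ y (mixFieldLp T (B l) n l)‖ₑ ^ 2 = ‖y‖ₑ ^ 2 := by
  have hm : ∀ l, MemLp (fun x => y x l) 2 (volume.restrict unitCube) := fun l =>
    (Lp.memLp y).of_le ((EuclideanSpace.proj (𝕜 := ℝ) l).continuous.comp_aestronglyMeasurable
      (Lp.memLp y).aestronglyMeasurable) (ae_of_all _ fun x => PiLp.norm_apply_le (y x) l)
  simp only [inner_mixFieldLp (Filter.EventuallyEq.refl _ (y : R3 → R3))]
  rw [Summable.tsum_finsetSum fun _ _ => ENNReal.summable]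
  have h1 : ∀ l, ∑' n, ‖∫ x in unitCube, y x l * mix T (B l) n x‖ₑ ^ 2 =
      ∫⁻ x in unitCube, ‖y x l‖ₑ ^ 2 := fun l => isParsevalFrame_mix T (B l) _ (hm l)
  simp only [h1]
  rw [← lintegral_finsetSum' _ fun l _ => (hm l).aestronglyMeasurable.enorm.pow_const 2]
  simp only [← enorm_sq_R3]
  rw [lintegral_enorm_sq_eq (Lp.memLp y), Lp.toLp_coeFn]

theorem sum_smul_mixFieldLp {B : Fin 3 → Finset (Fin 3)} {n : Fin 3 → ℕ} {c : Fin 3 → ℝ}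
    {g : R3 → R3} (hg : MemLp g 2 (volume.restrict unitCube))
    (h : ∀ x i, g x i = c i * mix T (B i) n x) :
    ∑ l, c l • mixFieldLp T (B l) n l = hg.toLp g := by
  unfold mixFieldLp
  rw [Fin.sum_univ_three, ← MemLp.toLp_const_smul, ← MemLp.toLp_const_smul,
    ← MemLp.toLp_const_smul, ← MemLp.toLp_add, ← MemLp.toLp_add]
  refine MemLp.toLp_congr _ _ (ae_of_all _ fun x => ?_)
  ext i
  rw [h]
  fin_cases i <;> simp [compField_apply]

theorem isTest_compField {φ : R3 → ℝ} (hφ : IsTest Γ φ) : IsTest Γ (compField φ l) where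
  smooth := hφ.smooth.smul contDiff_const
  compact := hφ.compact.mono fun x hx h => hx (by simp [compField, h])
  dist_pos := by
    obtain ⟨δ, hδ, h⟩ := hφ.dist_pos
    exact ⟨δ, hδ, fun x hx => h x (closure_mono
      (s := Function.support (compField φ l)) (t := Function.support φ)
      (fun y hy h0 => hy (by simp [compField, h0])) hx)⟩

theorem gradient_apply {φ : R3 → ℝ} (i : Fin 3) (x : R3) :
    gradient φ x i = partialS φ i x := by
  have h := InnerProductSpace.toDual_symm_apply (𝕜 := ℝ) (x := EuclideanSpace.single i (1 : ℝ))
    (y := fderiv ℝ φ x)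
  rw [EuclideanSpace.inner_single_right] at h
  simpa [gradient, partialS] using h

theorem continuous_gradient {φ : R3 → ℝ} (hφ : ContDiff ℝ 1 φ) : Continuous (gradient φ) :=
  (InnerProductSpace.toDual ℝ R3).symm.continuous.comp (hφ.continuous_fderiv (by norm_num))

theorem partialD_eq {Φ : R3 → R3} {x : R3} (hΦ : DifferentiableAt ℝ Φ x) (j i : Fin 3) :
    partialD Φ j i x = partialS (fun y => Φ y i) j x := by
  have h := ((EuclideanSpace.proj (𝕜 := ℝ) i : R3 →L[ℝ] ℝ).hasFDerivAt).comp x hΦ.hasFDerivAt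
  have h2 : fderiv ℝ (fun y => Φ y i) x = _ := h.fderiv
  rw [partialS, h2]
  rfl

theorem continuous_rot {Φ : R3 → R3} (hΦ : ContDiff ℝ 1 Φ) : Continuous (rot Φ) := by
  have h : ∀ j i, Continuous (partialD Φ j i) := fun j i =>
    (EuclideanSpace.proj (𝕜 := ℝ) i).continuous.comp
      ((hΦ.continuous_fderiv (by norm_num)).clm_apply continuous_const)
  refine (PiLp.continuous_toLp 2 _).comp (continuous_pi fun i => ?_)
  fin_cases i
  · exact (h 1 2).sub (h 2 1)
  · exact (h 2 0).sub (h 0 2)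
  · exact (h 0 1).sub (h 1 0)

theorem partialS_zero (i : Fin 3) (x : R3) : partialS (fun _ => 0) i x = 0 := by
  simp [partialS]

/-- The matrix of the cross product with `ω`. -/
def crossMatrix (ω : Fin 3 → ℝ) : Matrix (Fin 3) (Fin 3) ℝ :=
  !![0, -ω 2, ω 1; ω 2, 0, -ω 0; -ω 1, ω 0, 0]

theorem rot_compField {x : R3} (hf : DifferentiableAt ℝ f x) (i : Fin 3) :
    rot (compField f l) x i = crossMatrix (fun k => partialS f k x) i l := by
  have hd : DifferentiableAt ℝ (compField f l) x := hf.smul_const _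
  simp only [rot, partialD_eq hd, compField_apply]
  fin_cases l <;> fin_cases i <;> simp [crossMatrix, partialS_zero]

/-- The vector of frequencies. -/
noncomputable def freqVec (T : Set (Fin 3 × Fin 2)) (n : Fin 3 → ℕ) (i : Fin 3) : ℝ :=
  faceFreq T i (n i)

theorem partialS_congr {f g : R3 → ℝ} {x : R3} (h : f =ᶠ[𝓝 x] g) (i : Fin 3) :
    partialS f i x = partialS g i x := by
  rw [partialS, partialS, h.fderiv_eq]

/-- The derivative `∂ₗ` exchanges the factor in direction `l`, which is why the target components
use `B = {l}`. Membership in the closure comes from the cutoff approximations; the coefficient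
identity is integration by parts for test functions, extended by continuity. -/
theorem isBlockDiagonal_grad (hΓ : IsFaceBoundary T Γ) :
    IsBlockDiagonal (gradTestGraph unitCube Γ).topologicalClosure
      (fun n (_ : Unit) => mixLp T ∅ n) (fun n l => mixFieldLp T {l} n l)
      (fun n => Matrix.of fun i _ => freqVec T n i) where
  parseval_left y := by simpa using parseval_mixLp T ∅ y
  parseval_right y := parseval_mixFieldLp T (fun l => {l}) y
  mem n _ := by
    have hF : ContDiff ℝ 1 (mix T ∅ n) := contDiff_mix.of_le (by simp)
    have hk : ∀ k, ContDiff ℝ 1 (mixApprox T ∅ n k) := fun k => contDiff_mixApprox.of_le (by simp)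
    simp only [Matrix.of_apply]
    rw [sum_smul_mixFieldLp (memLp_unitCube (continuous_gradient hF)) fun x i => by
      rw [gradient_apply, partialS_mix (Finset.notMem_empty i), insert_empty_eq, freqVec]]
    have hb : ∀ i : Fin 3, ∃ C, ∀ k, ∀ x ∈ unitCube, |partialS (mixApprox T ∅ n k) i x| ≤ C :=
      fun i => exists_abs_partialS_mixApprox_le (Finset.notMem_empty i)
    choose C hC using hb
    have t1 := tendsto_toLp_unitCube (fun k => memLp_unitCube (hk k).continuous)
      (memLp_unitCube (hF.continuous)) (fun k x _ => abs_mixApprox_le) fun x hx => by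
        filter_upwards [eventually_mixApprox_eq hx] with k h using h.eq_of_nhds
    have t2 := tendsto_toLp_unitCube (fun k => memLp_unitCube (continuous_gradient (hk k)))
      (memLp_unitCube (continuous_gradient hF)) (C := 2 * (|C 0| + |C 1| + |C 2|))
      (fun k x hx => norm_R3_le fun i => by
        rw [gradient_apply]
        refine (hC i k x hx).trans ?_
        have := le_abs_self (C i)
        fin_cases i <;> simp at this ⊢ <;>
          linarith [abs_nonneg (C 0), abs_nonneg (C 1), abs_nonneg (C 2)]) fun x hx => by
        filter_upwards [eventually_mixApprox_eq hx] with k h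
        ext i
        rw [gradient_apply, gradient_apply, partialS_congr h]
    refine mem_closure_of_tendsto (t1.prodMk_nhds t2) (Eventually.of_forall fun k => ?_)
    exact ⟨_, isTest_mixApprox hΓ, MemLp.coeFn_toLp (memLp_unitCube (hk k).continuous),
      MemLp.coeFn_toLp (memLp_unitCube (continuous_gradient (hk k)))⟩
  coeff z hz n l := by
    simp only [Matrix.mulVec, dotProduct, Matrix.of_apply, Finset.univ_unique,
      Finset.sum_singleton]
    have hz' : z ∈ closure (gradTestGraph unitCube Γ : Set (L2s unitCube × L2v unitCube)) := hz
    refine closure_minimal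
      (t := {z : L2s unitCube × L2v unitCube |
      inner ℝ z.2 (mixFieldLp T {l} n l) = freqVec T n l * inner ℝ z.1 (mixLp T ∅ n)})
      ?_ (isClosed_eq (by fun_prop) (by fun_prop)) hz'
    rintro ⟨y, z⟩ ⟨φ, hφ, h1, h2⟩
    change inner ℝ z _ = _ * inner ℝ y _
    rw [inner_mixFieldLp h2, inner_mixLp h1]
    simp only [gradient_apply]
    exact integral_partialS_mul_mix (B := ∅) (hφ.smooth.of_le (by simp))
      (fun s hs x hx => hφ.eq_zero (hΓ.cubeFace_subset _ hs hx)) (Finset.notMem_empty l)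

/-- Component `i ≠ j` of the rotation differentiates the field in the remaining direction `k`. This
exchanges factor `k` in addition to `j`, and `{k, j}` is the complement of `{i}`. -/
theorem rot_compField_mix (n : Fin 3 → ℕ) (j : Fin 3) (x : R3) (i : Fin 3) :
    rot (compField (mix T {j} n) j) x i = crossMatrix (freqVec T n) i j * mix T {i}ᶜ n x := by
  rw [rot_compField (contDiff_mix.differentiable (by simp) x)]
  have h : ∀ i j k : Fin 3, i ≠ j → insert i {j} = ({k} : Finset (Fin 3))ᶜ →
      partialS (mix T {j} n) i x = freqVec T n i * mix T {k}ᶜ n x := fun i j k hij hk => by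
    rw [partialS_mix (by simpa using hij), hk, freqVec]
  have h10 := h 1 0 2 (by decide) (by decide)
  have h20 := h 2 0 1 (by decide) (by decide)
  have h01 := h 0 1 2 (by decide) (by decide)
  have h21 := h 2 1 0 (by decide) (by decide)
  have h02 := h 0 2 1 (by decide) (by decide)
  have h12 := h 1 2 0 (by decide) (by decide)
  fin_cases j <;> fin_cases i <;> simp [crossMatrix, h10, h20, h01, h21, h02, h12]

/-- In the source, component `j` has its own direction exchanged, as is natural for a tangential
condition: it vanishes on the faces in `T` of the other two directions only. -/
theorem isBlockDiagonal_rot (hΓ : IsFaceBoundary T Γ) :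
    IsBlockDiagonal (rotTestGraph unitCube Γ).topologicalClosure
      (fun n j => mixFieldLp T {j} n j) (fun n l => mixFieldLp T {l}ᶜ n l)
      (fun n => crossMatrix (freqVec T n)) where
  parseval_left y := parseval_mixFieldLp T (fun l => {l}) y
  parseval_right y := parseval_mixFieldLp T (fun l => {l}ᶜ) y
  mem n j := by
    have hF : ContDiff ℝ 1 (compField (mix T {j} n) j) :=
      (contDiff_mix.of_le (by simp)).smul contDiff_const
    have hk : ∀ k, ContDiff ℝ 1 (compField (mixApprox T {j} n k) j) := fun k =>
      (contDiff_mixApprox.of_le (by simp)).smul contDiff_const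
    have hkd : ∀ k, Differentiable ℝ (mixApprox T {j} n k) := fun k =>
      contDiff_mixApprox.differentiable (by simp)
    rw [sum_smul_mixFieldLp (memLp_unitCube (continuous_rot hF)) (rot_compField_mix n j)]
    -- Component `j` is never differentiated in direction `j`, the one direction in which its factor
    -- need not vanish at the Dirichlet ends and no uniform bound is available.
    have hb : ∀ i : Fin 3, ∃ C, i ≠ j → ∀ k, ∀ x ∈ unitCube,
        |partialS (mixApprox T {j} n k) i x| ≤ C := fun i => by
      by_cases hij : i = j
      · exact ⟨0, fun h => absurd hij h⟩
      · obtain ⟨C, hC⟩ := exists_abs_partialS_mixApprox_le (T := T) (B := {j}) (n := n)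
          (by simpa using hij)
        exact ⟨C, fun _ => hC⟩
    choose C hC using hb
    have t1 := tendsto_toLp_unitCube (fun k => memLp_unitCube (hk k).continuous)
      (memLp_unitCube (hF.continuous)) (C := 2 ^ 3)
      (fun k x _ => by rw [norm_compField]; exact abs_mixApprox_le) fun x hx => by
        filter_upwards [eventually_mixApprox_eq hx] with k h
        rw [compField, h.eq_of_nhds, compField]
    have t2 := tendsto_toLp_unitCube (fun k => memLp_unitCube (continuous_rot (hk k)))
      (memLp_unitCube (continuous_rot hF)) (C := 2 * (|C 0| + |C 1| + |C 2|))
      (fun k x hx => norm_R3_le fun i => by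
        rw [rot_compField (hkd k x)]
        have hC' : ∀ i ≠ j, |partialS (mixApprox T {j} n k) i x| ≤ |C i| := fun i hi =>
          (hC i hi k x hx).trans (le_abs_self _)
        have p0 := abs_nonneg (C 0)
        have p1 := abs_nonneg (C 1)
        have p2 := abs_nonneg (C 2)
        have c0 := hC' 0
        have c1 := hC' 1
        have c2 := hC' 2
        clear hC' hC t1 hkd hk hF
        fin_cases j <;> fin_cases i <;> simp [crossMatrix] at c0 c1 c2 ⊢ <;> linarith)
      fun x hx => by
        filter_upwards [eventually_mixApprox_eq (T := T) (B := {j}) (n := n) hx] with k h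
        ext i
        rw [rot_compField (hkd k x), rot_compField (contDiff_mix.differentiable (by simp) x)]
        simp only [partialS_congr h]
    refine mem_closure_of_tendsto (t1.prodMk_nhds t2) (Eventually.of_forall fun k => ?_)
    exact ⟨_, isTest_compField (isTest_mixApprox hΓ),
      MemLp.coeFn_toLp (memLp_unitCube (hk k).continuous),
      MemLp.coeFn_toLp (memLp_unitCube (continuous_rot (hk k)))⟩
  coeff z hz n l := by
    have hz' : z ∈ closure (rotTestGraph unitCube Γ : Set (L2v unitCube × L2v unitCube)) := hz
    refine closure_minimal
      (t := {z : L2v unitCube × L2v unitCube |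
      inner ℝ z.2 (mixFieldLp T {l}ᶜ n l) =
        ∑ j, crossMatrix (freqVec T n) l j * inner ℝ z.1 (mixFieldLp T {j} n j)})
      ?_ (isClosed_eq (by fun_prop) (by fun_prop)) hz'
    rintro ⟨y, z⟩ ⟨Φ, hΦ, h1, h2⟩
    change inner ℝ z _ = ∑ j, _ * inner ℝ y _
    simp only [inner_mixFieldLp h2, inner_mixFieldLp h1]
    have hc : ∀ i, ContDiff ℝ 1 fun x => Φ x i := fun i =>
      ((EuclideanSpace.proj (𝕜 := ℝ) i).contDiff.comp hΦ.smooth).of_le (by simp)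
    -- Every derivative occurring in the rotation is `∂ᵢ` of component `j` with `i ≠ j`, paired with
    -- the target component in the third direction `k`.
    have h : ∀ i j k : Fin 3, i ≠ j → insert i {j} = ({k} : Finset (Fin 3))ᶜ →
        ∫ x in unitCube, partialS (fun y => Φ y j) i x * mix T {k}ᶜ n x =
          freqVec T n i * ∫ x in unitCube, Φ x j * mix T {j} n x := fun i j k hij hk => by
      rw [← hk]
      exact integral_partialS_mul_mix (B := {j}) (hc j) (fun s hs x hx => by
        rw [hΦ.eq_zero (hΓ.cubeFace_subset _ hs hx)]; rfl) (by simpa using hij)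
    have hi : ∀ i j k : Fin 3, IntegrableOn
        (fun x => partialS (fun y => Φ y j) i x * mix T {k}ᶜ n x) unitCube := fun i j k =>
      integrable_unitCube ((((hc j).continuous_fderiv (by norm_num)).clm_apply
        continuous_const).mul continuous_mix)
    have h10 := h 1 0 2 (by decide) (by decide)
    have h20 := h 2 0 1 (by decide) (by decide)
    have h01 := h 0 1 2 (by decide) (by decide)
    have h21 := h 2 1 0 (by decide) (by decide)
    have h02 := h 0 2 1 (by decide) (by decide)
    have h12 := h 1 2 0 (by decide) (by decide)
    simp only [rot, partialD_eq (hΦ.differentiableAt _)]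
    rw [Fin.sum_univ_three]
    fin_cases l <;> simp [crossMatrix, sub_mul] <;> rw [integral_sub (hi _ _ _) (hi _ _ _)] <;>
      linarith

end Fields

/-! ### Geometry of the faces -/

section Geometry

variable {T : Set (Fin 3 × Fin 2)} {x : R3} {p : Fin 3 × Fin 2}

theorem isOpen_unitCube : IsOpen unitCube := by
  simp only [unitCube, ofPred_forall]
  exact isOpen_iInter_of_finite fun i => isOpen_Ioo.preimage (by fun_prop)

theorem closure_unitCube_subset : closure unitCube ⊆ {x | ∀ i, x i ∈ Icc (0 : ℝ) 1} := by
  refine closure_minimal (fun x hx i => Ioo_subset_Icc_self (hx i)) ?_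
  simp only [ofPred_forall]
  exact isClosed_iInter fun i => isClosed_Icc.preimage (by fun_prop)

theorem exists_mem_plane_of_mem_frontier (hx : x ∈ frontier unitCube) :
    (∀ i, x i ∈ Icc (0 : ℝ) 1) ∧ ∃ p : Fin 3 × Fin 2, x p.1 = ((p.2 : ℕ) : ℝ) := by
  rw [isOpen_unitCube.frontier_eq] at hx
  have hc := closure_unitCube_subset hx.1
  refine ⟨hc, ?_⟩
  by_contra! h
  refine hx.2 fun i => ⟨lt_of_le_of_ne (hc i).1 fun h0 => h (i, 0) ?_,
    lt_of_le_of_ne (hc i).2 fun h1 => h (i, 1) ?_⟩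
  · simpa using h0.symm
  · simpa using h1

theorem face_value_cases (s : Fin 2) : ((s : ℕ) : ℝ) = 0 ∨ ((s : ℕ) : ℝ) = 1 := by
  fin_cases s <;> simp

/-- Points of the closed cube are limits of points of the open segment to `z`. -/
theorem mem_closure_of_segment {S : Set R3} {z : R3}
    (h : ∀ t : ℝ, 0 < t → t < 1 → x + t • (z - x) ∈ S) : x ∈ closure S := by
  have hc : Tendsto (fun t : ℝ => x + t • (z - x)) (𝓝[>] 0) (𝓝 x) := by
    have : Continuous fun t : ℝ => x + t • (z - x) := by fun_prop
    have h2 := this.tendsto 0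
    simp only [zero_smul, add_zero] at h2
    exact h2.mono_left nhdsWithin_le_nhds
  refine mem_closure_of_tendsto hc ?_
  filter_upwards [Ioo_mem_nhdsGT (zero_lt_one (α := ℝ))] with t ht
  exact h t ht.1 ht.2

theorem mem_Ioo_of_segment {a b t : ℝ} (ha : a ∈ Icc (0 : ℝ) 1) (hb : b ∈ Ioo (0 : ℝ) 1)
    (h0 : 0 < t) (h1 : t < 1) : a + t * (b - a) ∈ Ioo (0 : ℝ) 1 := by
  have e1 : a + t * (b - a) = (1 - t) * a + t * b := by ring
  have e2 : 0 < t * b := mul_pos h0 hb.1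
  have e3 : 0 ≤ (1 - t) * a := mul_nonneg (by linarith) ha.1
  have e4 : t * b < t * 1 := mul_lt_mul_of_pos_left hb.2 h0
  have e5 : (1 - t) * a ≤ (1 - t) * 1 := mul_le_mul_of_nonneg_left ha.2 (by linarith)
  rw [e1]
  constructor <;> linarith

theorem mem_Icc_of_mem_cubeFace (hx : x ∈ cubeFace p) (i : Fin 3) : x i ∈ Icc (0 : ℝ) 1 := by
  by_cases hi : i = p.1
  · rw [hi, hx.1]
    rcases face_value_cases p.2 with h | h <;> simp [h]
  · exact Ioo_subset_Icc_self (hx.2 i hi)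

theorem cubeFace_subset_frontier : cubeFace p ⊆ frontier unitCube := by
  intro x hx
  rw [isOpen_unitCube.frontier_eq]
  refine ⟨mem_closure_of_segment (z := WithLp.toLp 2 fun _ => 1 / 2) fun t h0 h1 i => ?_,
    fun h => ?_⟩
  · exact mem_Ioo_of_segment (mem_Icc_of_mem_cubeFace hx i) (by norm_num) h0 h1
  · have h2 := h p.1
    rw [hx.1] at h2
    rcases face_value_cases p.2 with h | h <;> simp [h] at h2

theorem mem_closure_cubeFace (hx : ∀ i, x i ∈ Icc (0 : ℝ) 1) (hp : x p.1 = ((p.2 : ℕ) : ℝ)) :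
    x ∈ closure (cubeFace p) := by
  refine mem_closure_of_segment
    (z := WithLp.toLp 2 fun i => if i = p.1 then ((p.2 : ℕ) : ℝ) else 1 / 2)
    fun t h0 h1 => ⟨?_, fun j hj => ?_⟩
  · simp [hp]
  · have := mem_Ioo_of_segment (hx j) (b := 1 / 2) (by norm_num) h0 h1
    simpa [hj] using this

/-- A point of an open face lies in no other plane of a face. -/
theorem eq_of_mem_cubeFace {q : Fin 3 × Fin 2} (hx : x ∈ cubeFace p)
    (hq : x q.1 = ((q.2 : ℕ) : ℝ)) : q = p := by
  have h1 : q.1 = p.1 := by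
    by_contra h
    have h2 := hx.2 q.1 h
    rw [hq] at h2
    rcases face_value_cases q.2 with h | h <;> simp [h] at h2
  refine Prod.ext h1 (Fin.ext ?_)
  rw [h1, hx.1] at hq
  exact Nat.cast_injective hq.symm

theorem closure_iUnion_cubeFace_subset :
    closure (⋃ p ∈ T, cubeFace p) ⊆ {y | ∃ p ∈ T, y p.1 = ((p.2 : ℕ) : ℝ)} := by
  refine closure_minimal (fun y hy => ?_) ?_
  · obtain ⟨p, hp, hy⟩ := mem_iUnion₂.1 hy
    exact ⟨p, hp, hy.1⟩
  · have : {y : R3 | ∃ p ∈ T, y p.1 = ((p.2 : ℕ) : ℝ)} =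
        ⋃ p ∈ T, {y : R3 | y p.1 = ((p.2 : ℕ) : ℝ)} := by
      ext y; simp
    rw [this]
    exact (Set.toFinite T).isClosed_biUnion fun p _ =>
      isClosed_eq (by fun_prop) continuous_const

theorem facePart_subset_closure : facePart T ⊆ closure (⋃ p ∈ T, cubeFace p) := by
  rintro x ⟨hx, U, _, hxU, hU⟩
  exact hU ⟨hxU, hx⟩

theorem cubeFace_subset_facePart (hp : p ∈ T) : cubeFace p ⊆ facePart T := by
  intro x hx
  -- This neighbourhood isolates the face `p`: the open conditions on the other coordinates exclude
  -- the adjacent faces, and the distance bound 1 excludes the opposite one.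
  refine ⟨cubeFace_subset_frontier hx,
    {y | (∀ j, j ≠ p.1 → y j ∈ Ioo (0 : ℝ) 1) ∧ |y p.1 - ((p.2 : ℕ) : ℝ)| < 1}, ?_,
    ⟨hx.2, by simp [hx.1]⟩, ?_⟩
  · have h2 : IsOpen {y : R3 | |y p.1 - ((p.2 : ℕ) : ℝ)| < 1} :=
      isOpen_lt (by fun_prop) continuous_const
    refine IsOpen.inter ?_ h2
    have : {y : R3 | ∀ j, j ≠ p.1 → y j ∈ Ioo (0 : ℝ) 1} =
        ⋂ j, ⋂ _ : j ≠ p.1, (fun y : R3 => y j) ⁻¹' Ioo (0 : ℝ) 1 := by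
      ext y; simp
    change IsOpen {y : R3 | ∀ j, j ≠ p.1 → y j ∈ Ioo (0 : ℝ) 1}
    rw [this]
    exact isOpen_iInter_of_finite fun i => isOpen_iInter_of_finite fun _ =>
      isOpen_Ioo.preimage (by fun_prop)
  · rintro y ⟨⟨hy1, hy2⟩, hy⟩
    obtain ⟨-, q, hq⟩ := exists_mem_plane_of_mem_frontier hy
    have h1 : q.1 = p.1 := by
      by_contra h
      have h2 := hy1 q.1 h
      rw [hq] at h2
      rcases face_value_cases q.2 with h | h <;> simp [h] at h2
    refine subset_closure (mem_iUnion₂.2 ⟨p, hp, ?_, hy1⟩)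
    rw [← h1, hq] at hy2
    rw [← h1, hq]
    rcases face_value_cases q.2 with h | h <;> rcases face_value_cases p.2 with h' | h' <;>
      simp [h, h'] at hy2 ⊢

theorem isFaceBoundary_facePart (T : Set (Fin 3 × Fin 2)) : IsFaceBoundary T (facePart T) where
  cubeFace_subset _ hp := cubeFace_subset_facePart hp
  subset_planes _ hy := closure_iUnion_cubeFace_subset (facePart_subset_closure hy)

/-- The closure of `facePart T` stays in the planes of the faces in `T`, and an open face outside
`T` meets none of them. Conversely, a boundary point in the plane of a face in `T` lies in the
closure of that open face and has been removed. -/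
theorem isFaceBoundary_compl (T : Set (Fin 3 × Fin 2)) :
    IsFaceBoundary Tᶜ (frontier unitCube \ closure (facePart T)) where
  cubeFace_subset p hp x hx := by
    refine ⟨cubeFace_subset_frontier hx, fun h => ?_⟩
    obtain ⟨q, hq, hxq⟩ := closure_iUnion_cubeFace_subset
      (closure_minimal facePart_subset_closure isClosed_closure h)
    rw [eq_of_mem_cubeFace hx hxq] at hq
    exact hp hq
  subset_planes y hy := by
    obtain ⟨hc, p, hp⟩ := exists_mem_plane_of_mem_frontier hy.1
    refine ⟨p, fun hpT => hy.2 ?_, hp⟩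
    exact closure_mono (cubeFace_subset_facePart hpT) (mem_closure_cubeFace hc hp)

end Geometry

/-! ### Admissible frequencies and the constants as minima -/

section Spectrum

variable {T : Set (Fin 3 × Fin 2)} {Γ : Set R3} {B : Finset (Fin 3)} {n : Fin 3 → ℕ} {l : Fin 3}

/-- The product eigenfunction `mix T B n` vanishes identically. -/
def MixVanishes (T : Set (Fin 3 × Fin 2)) (B : Finset (Fin 3)) (n : Fin 3 → ℕ) : Prop :=
  ∃ j, freqVec T n j = 0 ∧ ((j, 0) ∈ T ↔ j ∉ B)

theorem amp_ne_zero {p q : Prop} {n : ℕ} : amp p q n ≠ 0 := by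
  unfold amp
  split_ifs <;> simp

/-- The condition on `T` and `B` says that factor `j` is a sine rather than a cosine, and a sine of
frequency zero vanishes. -/
theorem mix_eq_zero (h : MixVanishes T B n) (x : R3) : mix T B n x = 0 := by
  obtain ⟨j, h0, h1⟩ := h
  unfold mix prodFun
  refine Finset.prod_eq_zero (Finset.mem_univ j) ?_
  have h0' : freq ((j, 0) ∈ T) ((j, 1) ∈ T) (n j) = 0 := h0
  by_cases hj : j ∈ B
  · have hT : (j, (0 : Fin 2)) ∉ T := fun h => h1.1 h hj
    rw [mixFactor, if_pos hj, faceNeu, neuFun, if_neg hT, h0']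
    simp
  · have hT : (j, (0 : Fin 2)) ∈ T := h1.2 hj
    rw [mixFactor, if_neg hj, faceDir, dirFun, if_pos hT, h0']
    simp

theorem exists_mix_ne_zero (h : ¬MixVanishes T B n) : ∃ x ∈ unitCube, mix T B n x ≠ 0 := by
  have hpos : ∀ j, 0 ≤ freqVec T n j := fun j => freq_nonneg
  have hpos2 : ∀ j, 0 < freqVec T n j + 2 := fun j => by linarith [hpos j]
  have hlt : ∀ j, freqVec T n j * (1 / (freqVec T n j + 2)) < 1 := fun j => by
    rw [mul_one_div, div_lt_one (hpos2 j)]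
    linarith
  -- The coordinate `t = 1/(ω + 2)` lies in `(0,1)` and has `ω t < 1 < π/2`, so cosines are positive
  -- there, and sines too if `ω > 0`.
  refine ⟨WithLp.toLp 2 fun j => 1 / (freqVec T n j + 2), fun j => ⟨?_, ?_⟩, ?_⟩
  · exact one_div_pos.2 (hpos2 j)
  · exact (div_lt_one (hpos2 j)).2 (by linarith [hpos j])
  · unfold mix prodFun
    refine Finset.prod_ne_zero_iff.2 fun j _ => ?_
    set t := 1 / (freqVec T n j + 2) with ht
    have h0 : 0 ≤ freqVec T n j * t :=
      mul_nonneg (hpos j) (one_div_nonneg.2 (hpos2 j).le)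
    have hcos : Real.cos (freqVec T n j * t) ≠ 0 := by
      refine (Real.cos_pos_of_mem_Ioo ⟨?_, ?_⟩).ne'
      · linarith [Real.pi_pos]
      · linarith [Real.pi_gt_three, hlt j]
    have hsin : freqVec T n j ≠ 0 → Real.sin (freqVec T n j * t) ≠ 0 := fun hne => by
      refine (Real.sin_pos_of_pos_of_lt_pi ?_ ?_).ne'
      · exact mul_pos (lt_of_le_of_ne (hpos j) hne.symm) (one_div_pos.2 (hpos2 j))
      · linarith [Real.pi_gt_three, hlt j]
    have hj : freqVec T n j = 0 → ¬((j, (0 : Fin 2)) ∈ T ↔ j ∉ B) := fun h1 h2 => h ⟨j, h1, h2⟩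
    change mixFactor T B n j t ≠ 0
    unfold mixFactor
    split_ifs with hB
    · refine mul_ne_zero amp_ne_zero ?_
      by_cases hT : (j, (0 : Fin 2)) ∈ T
      · rw [if_pos hT]
        exact hcos
      · rw [if_neg hT]
        exact neg_ne_zero.2 (hsin fun h1 => hj h1 (by simp [hT, hB]))
    · refine mul_ne_zero amp_ne_zero ?_
      by_cases hT : (j, (0 : Fin 2)) ∈ T
      · rw [if_pos hT]
        exact hsin fun h1 => hj h1 (by simp [hT, hB])
      · rw [if_neg hT]
        exact hcos

theorem mix_not_ae_zero (h : ¬MixVanishes T B n) :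
    ¬(mix T B n =ᵐ[volume.restrict unitCube] fun _ => 0) := by
  intro h0
  obtain ⟨x, hx, hx0⟩ := exists_mix_ne_zero h
  exact hx0 (Measure.eqOn_open_of_ae_eq h0 isOpen_unitCube continuous_mix.continuousOn
    continuousOn_const hx)

theorem mixLp_eq_zero_iff : mixLp T B n = 0 ↔ MixVanishes T B n := by
  refine ⟨fun h => ?_, fun h => ?_⟩
  · by_contra hv
    refine mix_not_ae_zero hv ?_
    have h1 := MemLp.coeFn_toLp (memLp_unitCube (continuous_mix (T := T) (B := B) (n := n)))
    rw [← mixLp, h] at h1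
    exact h1.symm.trans (Lp.coeFn_zero _ _ _)
  · rw [mixLp, ← MemLp.toLp_zero (MemLp.zero (ε := ℝ) (p := 2) (μ := volume.restrict unitCube))]
    exact MemLp.toLp_congr _ _ (ae_of_all _ fun x => mix_eq_zero h x)

theorem mixFieldLp_eq_zero_iff : mixFieldLp T B n l = 0 ↔ MixVanishes T B n := by
  refine ⟨fun h => ?_, fun h => ?_⟩
  · by_contra hv
    refine mix_not_ae_zero hv ?_
    have h1 := MemLp.coeFn_toLp (memLp_unitCube (continuous_compField (l := l)
      (continuous_mix (T := T) (B := B) (n := n))))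
    rw [← mixFieldLp, h] at h1
    filter_upwards [h1.symm.trans (Lp.coeFn_zero _ _ _)] with x hx
    have := congrArg norm hx
    rw [norm_compField] at this
    simpa using this
  · rw [mixFieldLp, ← MemLp.toLp_zero (MemLp.zero (ε := R3) (p := 2) (μ := volume.restrict unitCube))]
    exact MemLp.toLp_congr _ _ (ae_of_all _ fun x => by simp [compField, mix_eq_zero h x])

/-- Length of the frequency vector. -/
noncomputable def freqNorm (T : Set (Fin 3 × Fin 2)) (n : Fin 3 → ℕ) : ℝ :=
  √(∑ i, freqVec T n i ^ 2)

theorem freqNorm_sq : freqNorm T n ^ 2 = ∑ i, freqVec T n i ^ 2 :=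
  Real.sq_sqrt (Finset.sum_nonneg fun _ _ => sq_nonneg _)

theorem freqNorm_pos (h : freqVec T n ≠ 0) : 0 < freqNorm T n := by
  obtain ⟨i, hi⟩ := Function.ne_iff.1 h
  exact Real.sqrt_pos.2 (Finset.sum_pos' (fun _ _ => sq_nonneg _)
    ⟨i, Finset.mem_univ i, by have : freqVec T n i ≠ 0 := hi; positivity⟩)

/-- The frequencies that contribute to the gradient. -/
def GradAdmissible (T : Set (Fin 3 × Fin 2)) (n : Fin 3 → ℕ) : Prop :=
  freqVec T n ≠ 0 ∧ ¬MixVanishes T ∅ n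

/-- The frequencies that contribute to the rotation. -/
def RotAdmissible (T : Set (Fin 3 × Fin 2)) (n : Fin 3 → ℕ) : Prop :=
  freqVec T n ≠ 0 ∧ ∃ a : Fin 3 → ℝ, a ≠ 0 ∧ freqVec T n ⬝ᵥ a = 0 ∧
    ∀ j, MixVanishes T {j} n → a j = 0

/-- The block is the column `ω`, which stretches by `|ω|`. It contributes unless `ω = 0`, when it
belongs to the kernel, or the product function itself is zero. -/
theorem laplaceConst_eq (hΓ : IsFaceBoundary T Γ) :
    laplaceConst unitCube Γ =
      (⨅ (n) (_ : GradAdmissible T n), ENNReal.ofReal (freqNorm T n))⁻¹ := by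
  refine (isBlockDiagonal_grad hΓ).poincareConst_eq _ _ (fun n a h1 h2 h3 => ?_)
    fun n hn => ⟨freqNorm_pos hn.1, fun _ => 1, ?_, ?_⟩
  · have ha : a () ≠ 0 := fun h => h3 (funext fun _ => h)
    refine ⟨⟨fun h0 => ha ?_, fun hv => ha (h1 () (mixLp_eq_zero_iff.2 hv))⟩, ?_⟩
    · have := h2 (fun _ => 1) (by funext i; simp [Matrix.mulVec, dotProduct, h0])
      simpa [dotProduct] using this
    · rw [freqNorm_sq]
      simp [Matrix.mulVec, dotProduct, mul_pow, Finset.sum_mul]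
  · funext u
    rw [freqNorm_sq]
    simp [Matrix.mulVec, dotProduct, sq]
  · simpa using fun h => hn.2 (mixLp_eq_zero_iff.1 h)

theorem crossMatrix_mulVec (ω a : Fin 3 → ℝ) :
    (crossMatrix ω).mulVec a =
      ![ω 1 * a 2 - ω 2 * a 1, ω 2 * a 0 - ω 0 * a 2, ω 0 * a 1 - ω 1 * a 0] := by
  funext i
  fin_cases i <;> simp [crossMatrix, Matrix.mulVec, dotProduct, Fin.sum_univ_three] <;> ring

/-- Lagrange's identity `|ω × a|² = |ω|²|a|² - (ω · a)²`. -/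
theorem sum_crossMatrix_mulVec_sq {ω a : Fin 3 → ℝ} (h : ω ⬝ᵥ a = 0) :
    ∑ i, (crossMatrix ω).mulVec a i ^ 2 = (∑ i, ω i ^ 2) * ∑ i, a i ^ 2 := by
  simp only [dotProduct, Fin.sum_univ_three] at h
  simp only [crossMatrix_mulVec, Fin.sum_univ_three, Matrix.cons_val]
  linear_combination -(ω 0 * a 0 + ω 1 * a 1 + ω 2 * a 2) * h

/-- The matrix is skew, and `-ω × (ω × a) = |ω|² a - (ω · a) ω`. -/
theorem crossMatrix_transpose_mulVec {ω a : Fin 3 → ℝ} (h : ω ⬝ᵥ a = 0) :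
    (crossMatrix ω).transpose.mulVec ((crossMatrix ω).mulVec a) = (∑ i, ω i ^ 2) • a := by
  simp only [dotProduct, Fin.sum_univ_three] at h
  funext i
  rw [crossMatrix_mulVec]
  fin_cases i <;>
    simp [crossMatrix, Matrix.mulVec, dotProduct, Fin.sum_univ_three, Matrix.transpose]
  · linear_combination -ω 0 * h
  · linear_combination -ω 1 * h
  · linear_combination -ω 2 * h

theorem inner_mixFieldLp_of_ne {B' : Finset (Fin 3)} {j : Fin 3} (h : j ≠ l) :
    inner ℝ (mixFieldLp T B' n j) (mixFieldLp T B n l) = 0 := by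
  have h1 : mixFieldLp T B' n j =ᵐ[volume.restrict unitCube] compField (mix T B' n) j :=
    MemLp.coeFn_toLp (memLp_unitCube (continuous_compField continuous_mix))
  rw [inner_mixFieldLp h1]
  simp [compField_apply, h.symm]

/-- Since `ω × ω = 0`, coefficients orthogonal to the kernel are orthogonal to `ω`, where the block
stretches by `|ω|`. If `ω = 0` the whole block is kernel. An admissible amplitude gives a nonzero
field because different components are orthogonal in `L²`. -/
theorem maxwellConst_eq (hΓ : IsFaceBoundary T Γ) :
    maxwellConst unitCube Γ =
      (⨅ (n) (_ : RotAdmissible T n), ENNReal.ofReal (freqNorm T n))⁻¹ := by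
  refine (isBlockDiagonal_rot hΓ).poincareConst_eq _ _ (fun n a h1 h2 h3 => ?_)
    fun n ⟨hn, a, ha0, haω, ha⟩ => ⟨freqNorm_pos hn, a, ?_, fun hs => ?_⟩
  · have haω : freqVec T n ⬝ᵥ a = 0 := h2 _ (by
      rw [crossMatrix_mulVec]
      funext i
      fin_cases i <;> simp [mul_comm])
    refine ⟨⟨fun h0 => h3 ?_, a, h3, haω, fun j hj => h1 j (mixFieldLp_eq_zero_iff.2 hj)⟩, ?_⟩
    · refine dotProduct_self_eq_zero.1 (h2 a ?_)
      rw [h0, crossMatrix_mulVec]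
      funext i
      fin_cases i <;> simp
    · rw [freqNorm_sq, sum_crossMatrix_mulVec_sq haω]
  · rw [freqNorm_sq, crossMatrix_transpose_mulVec haω]
  · refine ha0 (funext fun j => ?_)
    by_contra hj
    have hv : mixFieldLp T {j} n j ≠ 0 := fun h => hj (ha j (mixFieldLp_eq_zero_iff.1 h))
    have h := congrArg (fun y => inner ℝ y (mixFieldLp T {j} n j)) hs
    simp only [inner_zero_left, sum_inner] at h
    rw [Finset.sum_eq_single j (fun i _ hi => by
      rw [real_inner_smul_left, inner_mixFieldLp_of_ne hi, mul_zero])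
      (fun h => absurd (Finset.mem_univ j) h), real_inner_smul_left, mul_eq_zero] at h
    exact h.elim hj fun h => hv (inner_self_eq_zero.1 h)

theorem freqVec_compl : freqVec Tᶜ n = freqVec T n := by
  funext i
  by_cases h0 : (i, (0 : Fin 2)) ∈ T <;> by_cases h1 : (i, (1 : Fin 2)) ∈ T <;>
    simp [freqVec, faceFreq, freq, h0, h1]

/-- The new amplitude is `ω × a`: it is orthogonal to `ω`, and nonzero since `|ω × a| = |ω||a|`. The
support condition is the one for the exchanged boundary parts because the rotation maps source modes
to target modes. -/
theorem RotAdmissible.compl (h : RotAdmissible T n) : RotAdmissible Tᶜ n := by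
  obtain ⟨h0, a, ha0, haω, ha⟩ := h
  have hv : ∀ m j, freqVec T n m = 0 → ((m, (0 : Fin 2)) ∈ T ↔ m ≠ j) → a j = 0 :=
    fun m j h1 h2 => ha j ⟨m, h1, by simpa using h2⟩
  refine ⟨by rwa [freqVec_compl], (crossMatrix (freqVec T n)).mulVec a, fun h => ?_, ?_, ?_⟩
  · have hs := sum_crossMatrix_mulVec_sq haω
    rw [h, ← freqNorm_sq] at hs
    have h2 : ∑ i, a i ^ 2 = 0 := by
      have := freqNorm_pos h0
      simpa [this.ne'] using hs.symm
    rw [Finset.sum_eq_zero_iff_of_nonneg fun _ _ => sq_nonneg _] at h2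
    exact ha0 (funext fun i => by simpa using h2 i (Finset.mem_univ i))
  · rw [freqVec_compl, crossMatrix_mulVec]
    simp [dotProduct, Fin.sum_univ_three]
    ring
  · rintro j ⟨m, hm, hT⟩
    rw [freqVec_compl] at hm
    simp only [mem_compl_iff, Finset.mem_singleton, not_iff_not] at hT
    rw [crossMatrix_mulVec]
    -- If `m = j`, then `(m, 0) ∈ T` and `a` has only component `m`, which does not enter component
    -- `m` of `ω × a`. If `m ≠ j`, both `ω m` and `a m` are zero, and each term of component `j`
    -- contains one of them.
    by_cases hmj : m = j
    · subst hmj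
      have hk : ∀ k, k ≠ m → a k = 0 := fun k hk => hv m k hm (by simp [hT, hk.symm])
      fin_cases m <;> simp [hk 0, hk 1, hk 2]
    · have hmm : a m = 0 := hv m m hm (by simp [hT, hmj])
      fin_cases m <;> fin_cases j <;> simp at hm hmm hmj ⊢ <;> simp [hm, hmm]

theorem maxwellConst_compl (T : Set (Fin 3 × Fin 2)) :
    maxwellConst unitCube (frontier unitCube \ closure (facePart T)) =
      maxwellConst unitCube (facePart T) := by
  have h : ∀ n, RotAdmissible Tᶜ n ↔ RotAdmissible T n := fun n =>
    ⟨fun h => by simpa using h.compl, fun h => h.compl⟩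
  rw [maxwellConst_eq (isFaceBoundary_compl T), maxwellConst_eq (isFaceBoundary_facePart T)]
  simp only [h, freqNorm, freqVec_compl]

end Spectrum

/-! ### Minimal admissible frequencies -/

section Table

variable {T : Set (Fin 3 × Fin 2)} {n : Fin 3 → ℕ} {i j k : Fin 3} {x : ℝ}

theorem sum_fin_three (hij : i ≠ j) (hjk : j ≠ k) (hik : i ≠ k) (f : Fin 3 → ℝ) :
    ∑ m, f m = f i + f j + f k := by
  have h : (Finset.univ : Finset (Fin 3)) = {i, j, k} := by
    revert i j k; decide
  rw [h, Finset.sum_insert (by simp [hij, hik]), Finset.sum_insert (by simp [hjk]),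
    Finset.sum_singleton, add_assoc]

theorem eq_or_eq_or_eq (hij : i ≠ j) (hjk : j ≠ k) (hik : i ≠ k) (m : Fin 3) :
    m = i ∨ m = j ∨ m = k := by
  revert i j k m; decide

theorem exists_third : ∀ i j : Fin 3, ∃ k, i ≠ k ∧ j ≠ k := by decide

theorem freqVec_even (h : (i, (0 : Fin 2)) ∈ T ↔ (i, 1) ∈ T) :
    freqVec T n i = n i * Real.pi := by
  rw [freqVec, faceFreq, freq, if_pos h]

theorem freqVec_odd (h : ¬((i, (0 : Fin 2)) ∈ T ↔ (i, 1) ∈ T)) :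
    freqVec T n i = (n i + 1 / 2) * Real.pi := by
  rw [freqVec, faceFreq, freq, if_neg h]

theorem freqVec_odd_ne_zero (h : ¬((i, (0 : Fin 2)) ∈ T ↔ (i, 1) ∈ T)) : freqVec T n i ≠ 0 := by
  rw [freqVec_odd h]
  positivity

theorem even_of_freqVec_eq_zero (h : freqVec T n i = 0) : (i, (0 : Fin 2)) ∈ T ↔ (i, 1) ∈ T := by
  by_contra h1
  exact freqVec_odd_ne_zero h1 h

theorem le_freqVec_sq (h : freqVec T n i ≠ 0) : 1 / 4 * Real.pi ^ 2 ≤ freqVec T n i ^ 2 := by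
  by_cases hE : (i, (0 : Fin 2)) ∈ T ↔ (i, 1) ∈ T
  · rw [freqVec_even hE] at h ⊢
    have h1 : (1 : ℝ) ≤ n i := by
      exact_mod_cast Nat.one_le_iff_ne_zero.2 fun h0 => h (by simp [h0])
    rw [mul_pow]
    gcongr
    nlinarith
  · rw [freqVec_odd hE, mul_pow]
    gcongr
    have : (0 : ℝ) ≤ n i := Nat.cast_nonneg _
    nlinarith

theorem le_freqVec_sq_of_even (hE : (i, (0 : Fin 2)) ∈ T ↔ (i, 1) ∈ T) (h : freqVec T n i ≠ 0) :
    Real.pi ^ 2 ≤ freqVec T n i ^ 2 := by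
  rw [freqVec_even hE] at h ⊢
  have h1 : (1 : ℝ) ≤ n i := by
    exact_mod_cast Nat.one_le_iff_ne_zero.2 fun h0 => h (by simp [h0])
  rw [mul_pow]
  nlinarith [sq_nonneg Real.pi, mul_le_mul h1 h1 zero_le_one (by positivity)]

/-- Here `q` is the least squared frequency in units of `π²`, and `hq` encodes `x = 1/(√q π)`. -/
theorem inv_iInf_freqNorm (Adm : (Fin 3 → ℕ) → Prop) (q : ℝ) (hx : 0 < x)
    (hq : x ^ 2 * (q * Real.pi ^ 2) = 1)
    (hlow : ∀ n, Adm n → q * Real.pi ^ 2 ≤ ∑ i, freqVec T n i ^ 2)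
    (hup : ∃ n, Adm n ∧ ∑ i, freqVec T n i ^ 2 = q * Real.pi ^ 2) :
    (⨅ (n) (_ : Adm n), ENNReal.ofReal (freqNorm T n))⁻¹ = ENNReal.ofReal x := by
  have hs : √(q * Real.pi ^ 2) = x⁻¹ := by
    have h1 : q * Real.pi ^ 2 = x⁻¹ ^ 2 := by
      rw [inv_pow]
      exact eq_inv_of_mul_eq_one_right hq
    rw [h1, Real.sqrt_sq (by positivity)]
  have h : (⨅ (n) (_ : Adm n), ENNReal.ofReal (freqNorm T n)) = ENNReal.ofReal x⁻¹ := by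
    refine le_antisymm ?_ (le_iInf₂ fun n hn => ENNReal.ofReal_le_ofReal ?_)
    · obtain ⟨n, hn, hn2⟩ := hup
      refine (iInf₂_le n hn).trans ?_
      rw [freqNorm, hn2, hs]
    · rw [← hs]
      exact Real.sqrt_le_sqrt (hlow n hn)
  rw [h, ENNReal.ofReal_inv_of_pos hx, inv_inv]

/-- The square of the lowest frequency in direction `m`, in units of `π²`. -/
noncomputable def faceWeight (T : Set (Fin 3 × Fin 2)) (m : Fin 3) : ℝ :=
  open Classical in
  if (m, 0) ∈ T ∧ (m, 1) ∈ T then 1 else if (m, 0) ∈ T ∨ (m, 1) ∈ T then 1 / 4 else 0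

/-- The three directions are minimized independently: sines with both ends fixed start at `π`, mixed
conditions at `π/2`, Neumann conditions at 0. Hypothesis `hq` excludes total weight zero, where the
minimizer would be the constant function in the kernel. -/
theorem cubeC0_eq_of_faceWeight (hij : i ≠ j) (hjk : j ≠ k) (hik : i ≠ k) (hx : 0 < x)
    (hq : x ^ 2 * ((faceWeight T i + faceWeight T j + faceWeight T k) * Real.pi ^ 2) = 1) :
    cubeC0 T = ENNReal.ofReal x := by
  classical
  rw [cubeC0, laplaceConst_eq (isFaceBoundary_facePart T)]
  rw [← sum_fin_three hij hjk hik] at hq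
  refine inv_iInf_freqNorm _ _ hx hq (fun n hn => ?_)
    ⟨fun m => if (m, 0) ∈ T ∧ (m, 1) ∈ T then 1 else 0, ⟨fun h0 => ?_, ?_⟩, ?_⟩
  · rw [Finset.sum_mul]
    refine Finset.sum_le_sum fun m _ => ?_
    have hv : freqVec T n m = 0 → (m, (0 : Fin 2)) ∉ T := fun h h1 => hn.2 ⟨m, h, by simpa using h1⟩
    unfold faceWeight
    split_ifs with h1 h2
    · rw [one_mul]
      exact le_freqVec_sq_of_even (by tauto) fun h => hv h h1.1
    · exact le_freqVec_sq (freqVec_odd_ne_zero (by tauto))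
    · rw [zero_mul]; positivity
  · have h1 : ∀ m, faceWeight T m = 0 := fun m => by
      have h2 : freqVec T _ m = 0 := congrFun h0 m
      have h3 := even_of_freqVec_eq_zero h2
      rw [freqVec_even h3] at h2
      unfold faceWeight
      split_ifs at h2 ⊢ with h4 h5
      · simp [Real.pi_ne_zero] at h2
      · tauto
      · rfl
    simp [h1] at hq
  · rintro ⟨m, hm, hT⟩
    have hT' : (m, (0 : Fin 2)) ∈ T := by simpa using hT
    have h3 := even_of_freqVec_eq_zero hm
    rw [freqVec_even h3, if_pos ⟨hT', h3.1 hT'⟩] at hm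
    simp [Real.pi_ne_zero] at hm
  · rw [Finset.sum_mul]
    refine Finset.sum_congr rfl fun m _ => ?_
    unfold faceWeight
    by_cases h1 : (m, (0 : Fin 2)) ∈ T <;> by_cases h2 : (m, (1 : Fin 2)) ∈ T <;>
      simp [freqVec, faceFreq, freq, h1, h2] <;> ring

/-- With no Dirichlet face the constant mode is the kernel, so the minimum is the first cosine in a
single direction. -/
theorem cubeC0_empty : cubeC0 ∅ = ENNReal.ofReal (1 / Real.pi) := by
  rw [cubeC0, laplaceConst_eq (isFaceBoundary_facePart ∅)]
  have hf : ∀ n m, freqVec ∅ n m = n m * Real.pi := fun n m => freqVec_even (by simp)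
  refine inv_iInf_freqNorm _ 1 (by positivity) (by field_simp) (fun n hn => ?_)
    ⟨fun m => if m = 0 then 1 else 0, ⟨fun h0 => ?_, ?_⟩, ?_⟩
  · obtain ⟨m, hm⟩ := Function.ne_iff.1 hn.1
    rw [one_mul]
    exact (le_freqVec_sq_of_even (by simp) hm).trans
      (Finset.single_le_sum (f := fun m => freqVec ∅ n m ^ 2) (fun _ _ => sq_nonneg _)
        (Finset.mem_univ m))
  · have := congrFun h0 0
    simp [hf, Real.pi_ne_zero] at this
  · rintro ⟨m, -, hT⟩
    simp at hT
  · simp [hf]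

/-- A zero frequency in a direction with both faces in `T` kills every component except the one
along it; with no face in `T` it kills just that one. Two zero frequencies of the first kind leave
nothing. Two of the second kind leave only the third component, which orthogonality to `ω ≠ 0` rules
out. -/
theorem RotAdmissible.ne_of_eq_zero (h : RotAdmissible T n) (hij : i ≠ j)
    (hi : freqVec T n i = 0) (hj : freqVec T n j = 0) :
    ¬((i, (0 : Fin 2)) ∈ T ↔ (j, (0 : Fin 2)) ∈ T) := by
  intro hT
  obtain ⟨h0, a, ha0, haω, ha⟩ := h
  have hv : ∀ m l, freqVec T n m = 0 → ((m, (0 : Fin 2)) ∈ T ↔ m ≠ l) → a l = 0 :=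
    fun m l h1 h2 => ha l ⟨m, h1, by simpa using h2⟩
  by_cases hiT : (i, (0 : Fin 2)) ∈ T
  · refine ha0 (funext fun l => ?_)
    by_cases hl : i = l
    · exact hv j l hj (by simpa [← hT, hiT] using fun h => hij (hl.trans h.symm))
    · exact hv i l hi (by simp [hiT, hl])
  · have hai : a i = 0 := hv i i hi (by simp [hiT])
    have haj : a j = 0 := hv j j hj (by simp [← hT, hiT])
    obtain ⟨k, hik, hjk⟩ : ∃ k, i ≠ k ∧ j ≠ k := exists_third i j
    have hk : freqVec T n k * a k = 0 := by
      have := haω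
      rw [dotProduct, sum_fin_three hij hjk hik, hai, haj] at this
      simpa using this
    have hωk : freqVec T n k ≠ 0 := fun h => h0 (funext fun m => by
      rcases eq_or_eq_or_eq hij hjk hik m with rfl | rfl | rfl <;> assumption)
    refine ha0 (funext fun m => ?_)
    rcases eq_or_eq_or_eq hij hjk hik m with rfl | rfl | rfl
    · exact hai
    · exact haj
    · exact (mul_eq_zero.1 hk).resolve_left hωk

/-- If direction `k` has zero frequency and both faces in `T`, only component `k` survives, and
`e_k` is orthogonal to `ω`. Otherwise components `i` and `j` survive, and `ω_j e_i - ω_i e_j` works.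
-/
theorem rotAdmissible_of_two (hij : i ≠ j) (hi : freqVec T n i ≠ 0) (hj : freqVec T n j ≠ 0) :
    RotAdmissible T n := by
  obtain ⟨k, hik, hjk⟩ : ∃ k, i ≠ k ∧ j ≠ k := exists_third i j
  refine ⟨fun h => hi (congrFun h i), ?_⟩
  by_cases hk : freqVec T n k = 0 ∧ (k, (0 : Fin 2)) ∈ T
  · refine ⟨Pi.single k 1, by simp, by simp [hk.1], fun l hl => ?_⟩
    obtain ⟨m, hm, hT⟩ := hl
    rcases eq_or_eq_or_eq hij hjk hik m with rfl | rfl | rfl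
    · exact absurd hm hi
    · exact absurd hm hj
    · have : l ≠ m := by simpa [hk.2, eq_comm] using hT
      simp [this]
  · refine ⟨Pi.single i (freqVec T n j) - Pi.single j (freqVec T n i), fun h => ?_, ?_,
      fun l hl => ?_⟩
    · have := congrFun h i
      simp [hij, hj] at this
    · rw [dotProduct, sum_fin_three hij hjk hik]
      simp [hij, hij.symm, hik.symm, hjk.symm]
      ring
    · obtain ⟨m, hm, hT⟩ := hl
      rcases eq_or_eq_or_eq hij hjk hik m with rfl | rfl | rfl
      · exact absurd hm hi
      · exact absurd hm hj
      · have hkT : (m, (0 : Fin 2)) ∉ T := fun h => hk ⟨hm, h⟩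
        have : m = l := by simpa [hkT] using hT
        subst this
        simp [hik.symm, hjk.symm]

/-- The amplitude `e_i` survives: direction `i` kills the components other than `i`, and direction
`j` can kill at most component `j`. This is how a mode with a single nonzero frequency arises. -/
theorem rotAdmissible_of_one (hij : i ≠ j) (hjk : j ≠ k) (hik : i ≠ k)
    (hi : freqVec T n i = 0) (hk : freqVec T n k ≠ 0) (hiT : (i, (0 : Fin 2)) ∈ T)
    (hjT : (j, (0 : Fin 2)) ∉ T) : RotAdmissible T n := by
  refine ⟨fun h => hk (congrFun h k), Pi.single i 1, by simp, by simp [hi], ?_⟩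
  rintro l ⟨m, hm, hT⟩
  rcases eq_or_eq_or_eq hij hjk hik m with rfl | rfl | rfl
  · have : l ≠ m := by simpa [hiT, eq_comm] using hT
    simp [this]
  · have : m = l := by simpa [hjT] using hT
    subst this
    simp [hij.symm]
  · exact absurd hm hk

theorem cubeC1_eq (q : ℝ) (hx : 0 < x) (hq : x ^ 2 * (q * Real.pi ^ 2) = 1)
    (hlow : ∀ n, RotAdmissible T n → q * Real.pi ^ 2 ≤ ∑ i, freqVec T n i ^ 2)
    (hup : ∃ n, RotAdmissible T n ∧ ∑ i, freqVec T n i ^ 2 = q * Real.pi ^ 2) :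
    cubeC1 T = ENNReal.ofReal x := by
  rw [cubeC1, maxwellConst_eq (isFaceBoundary_facePart T)]
  exact inv_iInf_freqNorm _ q hx hq hlow hup

/-- Direction `i` has none or both of its faces in `T`. -/
abbrev EvenDir (T : Set (Fin 3 × Fin 2)) (i : Fin 3) : Prop :=
  (i, (0 : Fin 2)) ∈ T ↔ (i, 1) ∈ T

/-- All directions are of the same kind, so at most one frequency can vanish; the other two are at
least `π`. -/
theorem cubeC1_of_even_of_iff (hE : ∀ i, EvenDir T i)
    (hD : ∀ i j : Fin 3, (i, (0 : Fin 2)) ∈ T ↔ (j, (0 : Fin 2)) ∈ T)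
    (hx : 0 < x) (hq : x ^ 2 * (2 * Real.pi ^ 2) = 1) : cubeC1 T = ENNReal.ofReal x := by
  have hf : ∀ n m, freqVec T n m = n m * Real.pi := fun n m => freqVec_even (hE m)
  refine cubeC1_eq 2 hx hq (fun n hn => ?_) ⟨fun m => if m = 2 then 0 else 1,
    rotAdmissible_of_two (i := 0) (j := 1) (by decide) (by simp [hf, Real.pi_ne_zero])
      (by simp [hf, Real.pi_ne_zero]), ?_⟩
  · have h : ∀ i j : Fin 3, i ≠ j → freqVec T n i = 0 → freqVec T n j ≠ 0 := fun i j hij h1 h2 =>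
      hn.ne_of_eq_zero hij h1 h2 (hD i j)
    have hp : ∀ i, freqVec T n i ≠ 0 → Real.pi ^ 2 ≤ freqVec T n i ^ 2 := fun i =>
      le_freqVec_sq_of_even (hE i)
    have hs : ∀ i, 0 ≤ freqVec T n i ^ 2 := fun i => sq_nonneg _
    rw [Fin.sum_univ_three]
    by_cases h0 : freqVec T n 0 = 0
    · linarith [hs 0, hp 1 (h 0 1 (by decide) h0), hp 2 (h 0 2 (by decide) h0)]
    · by_cases h1 : freqVec T n 1 = 0
      · linarith [hs 1, hp 0 h0, hp 2 (h 1 2 (by decide) h1)]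
      · linarith [hs 2, hp 0 h0, hp 1 h1]
  · simp [hf, Fin.sum_univ_three]
    ring

/-- The odd direction costs at least `1/4`. The two even ones are of the same kind and cannot both
have frequency zero, which adds 1. -/
theorem cubeC1_of_one_odd_of_iff (hij : i ≠ j) (hjk : j ≠ k) (hik : i ≠ k)
    (hi : ¬EvenDir T i) (hj : EvenDir T j) (hk : EvenDir T k)
    (hD : (j, (0 : Fin 2)) ∈ T ↔ (k, (0 : Fin 2)) ∈ T)
    (hx : 0 < x) (hq : x ^ 2 * (5 / 4 * Real.pi ^ 2) = 1) : cubeC1 T = ENNReal.ofReal x := by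
  refine cubeC1_eq _ hx hq (fun n hn => ?_) ⟨fun m => if m = j then 1 else 0,
    rotAdmissible_of_two hij (freqVec_odd_ne_zero hi)
      (by rw [freqVec_even hj]; simp [Real.pi_ne_zero]), ?_⟩
  · rw [sum_fin_three hij hjk hik]
    have h1 := le_freqVec_sq (freqVec_odd_ne_zero (n := n) hi)
    by_cases h0 : freqVec T n j = 0
    · have h2 := le_freqVec_sq_of_even hk fun h => hn.ne_of_eq_zero hjk h0 h hD
      linarith [sq_nonneg (freqVec T n j)]
    · have h2 := le_freqVec_sq_of_even hj h0
      linarith [sq_nonneg (freqVec T n k)]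
  · rw [sum_fin_three hij hjk hik, freqVec_odd hi, freqVec_even hj, freqVec_even hk]
    simp [hij, hjk.symm]
    ring

/-- Directions of both kinds allow two zero frequencies, so the only remaining constraint is `ω ≠
0`. -/
theorem cubeC1_of_even_of_not_iff (hij : i ≠ j) (hjk : j ≠ k) (hik : i ≠ k)
    (hi : EvenDir T i) (hj : EvenDir T j) (hk : EvenDir T k)
    (hiT : (i, (0 : Fin 2)) ∈ T) (hjT : (j, (0 : Fin 2)) ∉ T)
    (hx : 0 < x) (hq : x ^ 2 * (1 * Real.pi ^ 2) = 1) : cubeC1 T = ENNReal.ofReal x := by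
  refine cubeC1_eq _ hx hq (fun n hn => ?_) ⟨fun m => if m = k then 1 else 0,
    rotAdmissible_of_one hij hjk hik (by rw [freqVec_even hi]; simp [hik])
      (by rw [freqVec_even hk]; simp [Real.pi_ne_zero]) hiT hjT, ?_⟩
  · obtain ⟨m, hm⟩ := Function.ne_iff.1 hn.1
    rw [one_mul]
    refine le_trans ?_ (Finset.single_le_sum (f := fun m => freqVec T n m ^ 2)
      (fun _ _ => sq_nonneg _) (Finset.mem_univ m))
    rcases eq_or_eq_or_eq hij hjk hik m with rfl | rfl | rfl
    · exact le_freqVec_sq_of_even hi hm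
    · exact le_freqVec_sq_of_even hj hm
    · exact le_freqVec_sq_of_even hk hm
  · rw [sum_fin_three hij hjk hik, freqVec_even hi, freqVec_even hj, freqVec_even hk]
    simp [hik, hjk]

theorem cubeC1_of_two_odd (hij : i ≠ j) (hjk : j ≠ k) (hik : i ≠ k)
    (hi : ¬EvenDir T i) (hj : ¬EvenDir T j) (hk : EvenDir T k)
    (hx : 0 < x) (hq : x ^ 2 * (1 / 2 * Real.pi ^ 2) = 1) : cubeC1 T = ENNReal.ofReal x := by
  refine cubeC1_eq _ hx hq (fun n _ => ?_) ⟨fun _ => 0,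
    rotAdmissible_of_two hij (freqVec_odd_ne_zero hi) (freqVec_odd_ne_zero hj), ?_⟩
  · rw [sum_fin_three hij hjk hik]
    linarith [le_freqVec_sq (freqVec_odd_ne_zero (n := n) hi),
      le_freqVec_sq (freqVec_odd_ne_zero (n := n) hj), sq_nonneg (freqVec T n k)]
  · rw [sum_fin_three hij hjk hik, freqVec_odd hi, freqVec_odd hj, freqVec_even hk]
    simp
    ring

/-- The two even directions are of different kinds and may both have frequency zero, so only the odd
one contributes. -/
theorem cubeC1_of_one_odd_of_not_iff (hij : i ≠ j) (hjk : j ≠ k) (hik : i ≠ k)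
    (hi : EvenDir T i) (hj : EvenDir T j) (hk : ¬EvenDir T k)
    (hiT : (i, (0 : Fin 2)) ∈ T) (hjT : (j, (0 : Fin 2)) ∉ T)
    (hx : 0 < x) (hq : x ^ 2 * (1 / 4 * Real.pi ^ 2) = 1) : cubeC1 T = ENNReal.ofReal x := by
  refine cubeC1_eq _ hx hq (fun n _ => ?_) ⟨fun _ => 0,
    rotAdmissible_of_one hij hjk hik (by rw [freqVec_even hi]; simp)
      (freqVec_odd_ne_zero hk) hiT hjT, ?_⟩
  · rw [sum_fin_three hij hjk hik]
    linarith [le_freqVec_sq (freqVec_odd_ne_zero (n := n) hk), sq_nonneg (freqVec T n i),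
      sq_nonneg (freqVec T n j)]
  · rw [sum_fin_three hij hjk hik, freqVec_even hi, freqVec_even hj, freqVec_odd hk]
    simp
    ring

theorem cubeC1_of_odd (hij : i ≠ j) (hjk : j ≠ k) (hik : i ≠ k)
    (hi : ¬EvenDir T i) (hj : ¬EvenDir T j) (hk : ¬EvenDir T k)
    (hx : 0 < x) (hq : x ^ 2 * (3 / 4 * Real.pi ^ 2) = 1) : cubeC1 T = ENNReal.ofReal x := by
  refine cubeC1_eq _ hx hq (fun n _ => ?_) ⟨fun _ => 0,
    rotAdmissible_of_two hij (freqVec_odd_ne_zero hi) (freqVec_odd_ne_zero hj), ?_⟩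
  · rw [sum_fin_three hij hjk hik]
    linarith [le_freqVec_sq (freqVec_odd_ne_zero (n := n) hi),
      le_freqVec_sq (freqVec_odd_ne_zero (n := n) hj),
      le_freqVec_sq (freqVec_odd_ne_zero (n := n) hk)]
  · rw [sum_fin_three hij hjk hik, freqVec_odd hi, freqVec_odd hj, freqVec_odd hk]
    simp
    ring

end Table

/-! ### Evaluation of the table -/

/-- A set with exactly one face in direction `i`. -/
theorem not_evenDir {T : Set (Fin 3 × Fin 2)} {i : Fin 3} (a : Fin 2)
    (h : ∀ s, (i, s) ∈ T ↔ s = a) : ¬EvenDir T i := by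
  have h1 : ∀ a : Fin 2, ¬((0 : Fin 2) = a ↔ 1 = a) := by decide
  rw [EvenDir, h, h]
  exact h1 a

theorem faceWeight_of_both {T : Set (Fin 3 × Fin 2)} {i : Fin 3} (h : ∀ s, (i, s) ∈ T) :
    faceWeight T i = 1 := by
  rw [faceWeight, if_pos ⟨h 0, h 1⟩]

theorem faceWeight_of_none {T : Set (Fin 3 × Fin 2)} {i : Fin 3} (h : ∀ s, (i, s) ∉ T) :
    faceWeight T i = 0 := by
  rw [faceWeight, if_neg fun h1 => h 0 h1.1, if_neg fun h1 => h1.elim (h 0) (h 1)]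

theorem faceWeight_of_one {T : Set (Fin 3 × Fin 2)} {i : Fin 3} (a : Fin 2)
    (h : ∀ s, (i, s) ∈ T ↔ s = a) : faceWeight T i = 1 / 4 := by
  have h1 : ∀ a : Fin 2, ¬(0 = a ∧ 1 = a) ∧ (0 = a ∨ 1 = a) := by decide
  rw [faceWeight, h, h, if_neg (h1 a).1, if_pos (h1 a).2]

theorem fin_two_cases (s : Fin 2) : s = 0 ∨ s = 1 := by
  revert s; decide

theorem laplaceTable (i j k : Fin 3) (hij : i ≠ j) (hjk : j ≠ k) (hik : i ≠ k) (a b c : Fin 2) :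
    cubeC0 ∅ = ENNReal.ofReal (1 / Real.pi) ∧
    cubeC0 {(i, a)} = ENNReal.ofReal (2 / Real.pi) ∧
    cubeC0 {(i, 0), (i, 1)} = ENNReal.ofReal (1 / Real.pi) ∧
    cubeC0 {(i, a), (j, b)} = ENNReal.ofReal (√2 / Real.pi) ∧
    cubeC0 {(i, 0), (i, 1), (j, a)} = ENNReal.ofReal (2 / (√5 * Real.pi)) ∧
    cubeC0 {(i, a), (j, b), (k, c)} = ENNReal.ofReal (2 / (√3 * Real.pi)) ∧
    cubeC0 {(i, 0), (i, 1), (j, 0), (j, 1)} = ENNReal.ofReal (1 / (√2 * Real.pi)) ∧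
    cubeC0 {(i, 0), (i, 1), (j, a), (k, b)} = ENNReal.ofReal (2 / (√6 * Real.pi)) ∧
    cubeC0 {(i, 0), (i, 1), (j, 0), (j, 1), (k, a)} = ENNReal.ofReal (2 / (3 * Real.pi)) ∧
    cubeC0 univ = ENNReal.ofReal (1 / (√3 * Real.pi)) := by
  have e2 : √2 ^ 2 = 2 := Real.sq_sqrt (by norm_num)
  have e3 : √3 ^ 2 = 3 := Real.sq_sqrt (by norm_num)
  have e5 : √5 ^ 2 = 5 := Real.sq_sqrt (by norm_num)
  have e6 : √6 ^ 2 = 6 := Real.sq_sqrt (by norm_num)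
  have hπ := Real.pi_ne_zero
  have hji := hij.symm
  have hkj := hjk.symm
  have hki := hik.symm
  refine ⟨cubeC0_empty, ?_, ?_, ?_, ?_, ?_, ?_, ?_, ?_, ?_⟩
  · refine cubeC0_eq_of_faceWeight hij hjk hik (by positivity) ?_
    rw [faceWeight_of_one a (by simp), faceWeight_of_none (by simp [*]),
      faceWeight_of_none (by simp [*])]
    field_simp
    norm_num
  · refine cubeC0_eq_of_faceWeight hij hjk hik (by positivity) ?_
    rw [faceWeight_of_both (by simp [fin_two_cases]), faceWeight_of_none (by simp [*]),
      faceWeight_of_none (by simp [*])]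
    field_simp
    norm_num
  · refine cubeC0_eq_of_faceWeight hij hjk hik (by positivity) ?_
    rw [faceWeight_of_one a (by simp [*]), faceWeight_of_one b (by simp [*]),
      faceWeight_of_none (by simp [*]), div_pow, e2]
    field_simp
    norm_num
  · refine cubeC0_eq_of_faceWeight hij hjk hik (by positivity) ?_
    rw [faceWeight_of_both (by simp [fin_two_cases, *]), faceWeight_of_one a (by simp [*]),
      faceWeight_of_none (by simp [*]), div_pow, mul_pow, e5]
    field_simp
    norm_num
  · refine cubeC0_eq_of_faceWeight hij hjk hik (by positivity) ?_
    rw [faceWeight_of_one a (by simp [*]), faceWeight_of_one b (by simp [*]),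
      faceWeight_of_one c (by simp [*]), div_pow, mul_pow, e3]
    field_simp
    norm_num
  · refine cubeC0_eq_of_faceWeight hij hjk hik (by positivity) ?_
    rw [faceWeight_of_both (by simp [fin_two_cases, *]),
      faceWeight_of_both (by simp [fin_two_cases, *]),
      faceWeight_of_none (by simp [*]), div_pow, mul_pow, e2]
    field_simp
    norm_num
  · refine cubeC0_eq_of_faceWeight hij hjk hik (by positivity) ?_
    rw [faceWeight_of_both (by simp [fin_two_cases, *]), faceWeight_of_one a (by simp [*]),
      faceWeight_of_one b (by simp [*]), div_pow, mul_pow, e6]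
    field_simp
    norm_num
  · refine cubeC0_eq_of_faceWeight hij hjk hik (by positivity) ?_
    rw [faceWeight_of_both (by simp [fin_two_cases, *]),
      faceWeight_of_both (by simp [fin_two_cases, *]),
      faceWeight_of_one a (by simp [*])]
    field_simp
    norm_num
  · refine cubeC0_eq_of_faceWeight hij hjk hik (by positivity) ?_
    rw [faceWeight_of_both (by simp), faceWeight_of_both (by simp),
      faceWeight_of_both (by simp), div_pow, mul_pow, e3]
    field_simp
    norm_num

theorem maxwellTable (i j k : Fin 3) (hij : i ≠ j) (hjk : j ≠ k) (hik : i ≠ k) (a b c : Fin 2) :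
    cubeC1 ∅ = ENNReal.ofReal (1 / (√2 * Real.pi)) ∧
    cubeC1 univ = ENNReal.ofReal (1 / (√2 * Real.pi)) ∧
    cubeC1 {(i, a)} = ENNReal.ofReal (2 / (√5 * Real.pi)) ∧
    cubeC1 {(i, 0), (i, 1)} = ENNReal.ofReal (1 / Real.pi) ∧
    cubeC1 {(i, a), (j, b)} = ENNReal.ofReal (√2 / Real.pi) ∧
    cubeC1 {(i, 0), (i, 1), (j, a)} = ENNReal.ofReal (2 / Real.pi) ∧
    cubeC1 {(i, a), (j, b), (k, c)} = ENNReal.ofReal (2 / (√3 * Real.pi)) ∧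
    cubeC1 {(i, 0), (i, 1), (j, 0), (j, 1)} = ENNReal.ofReal (1 / Real.pi) ∧
    cubeC1 {(i, 0), (i, 1), (j, a), (k, b)} = ENNReal.ofReal (√2 / Real.pi) ∧
    cubeC1 {(i, 0), (i, 1), (j, 0), (j, 1), (k, a)} =
      ENNReal.ofReal (2 / (√5 * Real.pi)) := by
  have hπ := Real.pi_ne_zero
  have hji := hij.symm
  have hkj := hjk.symm
  have hki := hik.symm
  have v2 : (1 / (√2 * Real.pi)) ^ 2 * (2 * Real.pi ^ 2) = 1 := by
    rw [div_pow, mul_pow, Real.sq_sqrt (by norm_num)]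
    field_simp
  have v5 : (2 / (√5 * Real.pi)) ^ 2 * (5 / 4 * Real.pi ^ 2) = 1 := by
    rw [div_pow, mul_pow, Real.sq_sqrt (by norm_num)]
    field_simp
    norm_num
  have v1 : (1 / Real.pi) ^ 2 * (1 * Real.pi ^ 2) = 1 := by field_simp
  have v2' : (√2 / Real.pi) ^ 2 * (1 / 2 * Real.pi ^ 2) = 1 := by
    rw [div_pow, Real.sq_sqrt (by norm_num)]
    field_simp
  have v4 : (2 / Real.pi) ^ 2 * (1 / 4 * Real.pi ^ 2) = 1 := by
    field_simp
    norm_num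
  have v3 : (2 / (√3 * Real.pi)) ^ 2 * (3 / 4 * Real.pi ^ 2) = 1 := by
    rw [div_pow, mul_pow, Real.sq_sqrt (by norm_num)]
    field_simp
    norm_num
  refine ⟨?_, ?_, ?_, ?_, ?_, ?_, ?_, ?_, ?_, ?_⟩
  · exact cubeC1_of_even_of_iff (by simp [EvenDir]) (by simp) (by positivity) v2
  · exact cubeC1_of_even_of_iff (by simp [EvenDir]) (by simp) (by positivity) v2
  · exact cubeC1_of_one_odd_of_iff hij hjk hik (not_evenDir a (by simp)) (by simp [EvenDir, *])
      (by simp [EvenDir, *]) (by simp [*]) (by positivity) v5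
  · exact cubeC1_of_even_of_not_iff hij hjk hik (by simp [EvenDir]) (by simp [EvenDir, *])
      (by simp [EvenDir, *]) (by simp) (by simp [*]) (by positivity) v1
  · exact cubeC1_of_two_odd hij hjk hik (not_evenDir a (by simp [*])) (not_evenDir b (by simp [*]))
      (by simp [EvenDir, *]) (by positivity) v2'
  -- The directions are permuted: `i` has both faces, `k` none, and `j` is the odd one.
  · exact cubeC1_of_one_odd_of_not_iff hik hkj hij (by simp [EvenDir]) (by simp [EvenDir, *])
      (not_evenDir a (by simp [*])) (by simp) (by simp [*]) (by positivity) v4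
  · exact cubeC1_of_odd hij hjk hik (not_evenDir a (by simp [*])) (not_evenDir b (by simp [*]))
      (not_evenDir c (by simp [*])) (by positivity) v3
  · exact cubeC1_of_even_of_not_iff hik hkj hij (by simp [EvenDir]) (by simp [EvenDir, *])
      (by simp [EvenDir, *]) (by simp) (by simp [*]) (by positivity) v1
  · exact cubeC1_of_two_odd hjk hki hji (not_evenDir a (by simp [*])) (not_evenDir b (by simp [*]))
      (by simp [EvenDir]) (by positivity) v2'
  -- Direction `k` is the odd one; `i` and `j` both have all their faces in the set.
  · exact cubeC1_of_one_odd_of_iff hki hij hkj (not_evenDir a (by simp [*])) (by simp [EvenDir])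
      (by simp [EvenDir]) (by simp) (by positivity) v5

theorem mainTheorem4 :
    (∀ i j k : Fin 3, i ≠ j → j ≠ k → i ≠ k → ∀ a b c : Fin 2,
      -- Laplace constants
      cubeC0 ∅ = ENNReal.ofReal (1 / Real.pi) ∧
      cubeC0 {(i, a)} = ENNReal.ofReal (2 / Real.pi) ∧
      cubeC0 {(i, 0), (i, 1)} = ENNReal.ofReal (1 / Real.pi) ∧
      cubeC0 {(i, a), (j, b)} = ENNReal.ofReal (√2 / Real.pi) ∧
      cubeC0 {(i, 0), (i, 1), (j, a)} = ENNReal.ofReal (2 / (√5 * Real.pi)) ∧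
      cubeC0 {(i, a), (j, b), (k, c)} = ENNReal.ofReal (2 / (√3 * Real.pi)) ∧
      cubeC0 {(i, 0), (i, 1), (j, 0), (j, 1)} = ENNReal.ofReal (1 / (√2 * Real.pi)) ∧
      cubeC0 {(i, 0), (i, 1), (j, a), (k, b)} = ENNReal.ofReal (2 / (√6 * Real.pi)) ∧
      cubeC0 {(i, 0), (i, 1), (j, 0), (j, 1), (k, a)} = ENNReal.ofReal (2 / (3 * Real.pi)) ∧
      cubeC0 univ = ENNReal.ofReal (1 / (√3 * Real.pi)) ∧
      -- Maxwell constants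
      cubeC1 ∅ = ENNReal.ofReal (1 / (√2 * Real.pi)) ∧
      cubeC1 univ = ENNReal.ofReal (1 / (√2 * Real.pi)) ∧
      cubeC1 {(i, a)} = ENNReal.ofReal (2 / (√5 * Real.pi)) ∧
      cubeC1 {(i, 0), (i, 1)} = ENNReal.ofReal (1 / Real.pi) ∧
      cubeC1 {(i, a), (j, b)} = ENNReal.ofReal (√2 / Real.pi) ∧
      cubeC1 {(i, 0), (i, 1), (j, a)} = ENNReal.ofReal (2 / Real.pi) ∧
      cubeC1 {(i, a), (j, b), (k, c)} = ENNReal.ofReal (2 / (√3 * Real.pi)) ∧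
      cubeC1 {(i, 0), (i, 1), (j, 0), (j, 1)} = ENNReal.ofReal (1 / Real.pi) ∧
      cubeC1 {(i, 0), (i, 1), (j, a), (k, b)} = ENNReal.ofReal (√2 / Real.pi) ∧
      cubeC1 {(i, 0), (i, 1), (j, 0), (j, 1), (k, a)} = ENNReal.ofReal (2 / (√5 * Real.pi))) ∧
    -- exchanging the two boundary parts `Γτ` and `Γν = Γ \ closure Γτ`
    (∀ T : Set (Fin 3 × Fin 2),
      maxwellConst unitCube (frontier unitCube \ closure (facePart T)) =
        maxwellConst unitCube (facePart T)) := by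
  exact ⟨fun i j k hij hjk hik a b c => by
    obtain ⟨h0, h1, h2, h3, h4, h5, h6, h7, h8, h9⟩ := laplaceTable i j k hij hjk hik a b c
    exact ⟨h0, h1, h2, h3, h4, h5, h6, h7, h8, h9, maxwellTable i j k hij hjk hik a b c⟩,
    maxwellConst_compl⟩
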